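/- Let $a<b$ be real numbers, $q\ge1$, $n\ge0$ integers, and let $s_0,s_1,\dots$ be complex $q\times q$ matrices. **Notation.** Put $$\widehat s_k=-ab\,s_k+(a+b)s_{k+1}-s_{k+2},\qquad s^{(1)}_k=b\,s_k-s_{k+1},\qquad s^{(2)}_k=-a\,s_k+s_{k+1},$$ and let $$H_{1,j}=(s_{i+k})_{i,k=0}^j,\quad H_{2,j}=(\widehat s_{i+k})_{i,k=0}^j,\quad K_{1,j}=(s^{(1)}_{i+k})_{i,k=0}^j,\quad K_{2,j}=(s^{(2)}_{i+k})_{i,k=0}^j$$ be the corresponding block Hankel matrices (empty for $j=-1$). The sequence $(s_k)_{k=0}^{2n}$ is called Hausdorff positive definite on $[a,b]$ if $H_{1,n}$ and $H_{2,n-1}$ are positive definite; $(s_k)_{k=0}^{2n+1}$ is called Hausdorff positive definite on $[a,b]$ if $K_{1,n}$ and $K_{2,n}$ are positive definite. Let $T_j$ be the $(j+1)q\times(j+1)q$ block matrix with blocks $I_q$ on the first block subdiagonal and $0$ elsewhere, $R_j(z)=(I-zT_j)^{-1}$, and let $v_j,u_{1,j},u_{2,j},\widetilde u_{1,j},\widetilde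 u_{2,j}$ be the block columns (with $j+1$ blocks of size $q\times q$) $$v_j=\begin{pmatrix}I_q\\0\\ \vdots\\0\end{pmatrix},\quad u_{1,j}=\begin{pmatrix}0\\-s_0\\ \vdots\\-s_{j-1}\end{pmatrix},\quad u_{2,j}=\begin{pmatrix}-(a+b)s_0+s_1\\-\widehat s_0\\ \vdots\\-\widehat s_{j-1}\end{pmatrix},\quad \widetilde u_{1,j}=\begin{pmatrix}s_0\\s_1-bs_0\\ \vdots\\s_j-bs_{j-1}\end{pmatrix},\quad \widetilde u_{2,j}=\begin{pmatrix}-s_0\\-s_1+as_0\\ \vdots\\-s_j+as_{j-1}\end{pmatrix}.$$ For a sequence $t=(t_k)$ of $q\times q$ matrices let $\rho_j[t]=\bigl(-Y^*G^{-1},\,I_q\bigr)$, where $Y$ is the block column with blocks $t_j,\dots,t_{2j-1}$ and $G=(t_{i+k})_{i,k=0}^{j-1}$ (so $\rho_0[t]=I_q$). Define $$P_{1,j}(z)=\rho_j[s]R_j(z)v_j,\quad Q_{1,j}(z)=-\rho_j[s]R_j(z)u_{1,j},\quad P_{2,j}(z)=\rho_j[\widehat s]R_j(z)v_j,\quad Q_{2,j}(z)=-\rho_j[\widehat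 s]R_j(z)(u_{2,j}+z\,v_js_0),$$ $$\Gamma_{k,j}(z)=\rho_j[s^{(k)}]R_j(z)v_j,\qquad \Theta_{k,j}(z)=\rho_j[s^{(k)}]R_j(z)\widetilde u_{k,j}\qquad(k=1,2),$$ and write $F^*(w)=(F(w))^*$, $F^{*^{-1}}(w)=((F(w))^*)^{-1}$. The resolvent matrices of the truncated Hausdorff matrix moment problem are $$U^{(2n)}(z)=\begin{pmatrix}\Theta_{2,n}^*(\bar z)\Theta_{2,n}^{*^{-1}}(a)&\frac1{b-a}\Theta_{1,n}^*(\bar z)\Gamma_{1,n}^{*^{-1}}(a)\\(z-a)\Gamma_{2,n}^*(\bar z)\Theta_{2,n}^{*^{-1}}(a)&\frac{b-z}{b-a}\Gamma_{1,n}^*(\bar z)\Gamma_{1,n}^{*^{-1}}(a)\end{pmatrix},$$ $$U^{(2n+1)}(z)=\begin{pmatrix}Q_{2,n}^*(\bar z)Q_{2,n}^{*^{-1}}(a)&-Q_{1,n+1}^*(\bar z)P_{1,n+1}^{*^{-1}}(a)\\-(z-a)(b-z)P_{2,n}^*(\bar z)Q_{2,n}^{*^{-1}}(a)&P_{1,n+1}^*(\bar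 z)P_{1,n+1}^{*^{-1}}(a)\end{pmatrix}.$$ With $\lambda_j=(u_{2,j}^*+as_0v_j^*)R_j^*(a)H_{2,j}^{-1}R_j(a)(u_{2,j}+av_js_0)$ and $\tau_j=v_j^*R_j^*(a)K_{1,j}^{-1}R_j(a)v_j$, the new Dyukarev–Stieltjes parameters are $$\mathbf l_{-1}=s_0,\quad \mathbf l_0=\lambda_0,\quad \mathbf l_j=\lambda_j-\lambda_{j-1}\ (j\ge1),\qquad \mathbf m_0=\tau_0,\quad \mathbf m_j=\tau_j-\tau_{j-1}\ (j\ge1).$$ With $\mu_j=v_j^*R_j^*(a)H_{1,j}^{-1}R_j(a)v_j$ and $\nu_j=\widetilde u_{2,j}^*R_j^*(a)K_{2,j}^{-1}R_j(a)\widetilde u_{2,j}$, the older ones are $$M_0=s_0^{-1},\quad M_j=\mu_j-\mu_{j-1}\ (j\ge1),\qquad L_0=\nu_0,\quad L_j=\nu_j-\nu_{j-1}\ (j\ge1).$$ For $q\times q$ matrices $X$ and scalars $c,d$ write $$\mathcal U(X)=\begin{pmatrix}I_q&X\\0&I_q\end{pmatrix},\qquad \mathcal L(X)=\begin{pmatrix}I_q&0\\X&I_q\end{pmatrix},\qquad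 \mathcal D(c,d)=\begin{pmatrix}cI_q&0\\0&dI_q\end{pmatrix},$$ and $\overrightarrow{\prod}_{k=0}^{N}A_k=A_0A_1\cdots A_N$ (the identity for $N=-1$). **Theorem.** (i) Let $(s_k)_{k=0}^{2n}$ be Hausdorff positive definite on $[a,b]$. Then $H_{1,j}$ ($0\le j\le n$) and $H_{2,j},K_{1,j},K_{2,j}$ ($0\le j\le n-1$) are positive definite, and $\Theta_{2,n}(a)$, $\Gamma_{1,n}(a)$, $P_{1,n}(a)$ and, if $n\ge1$, $Q_{2,n-1}(a)$ are invertible, so that all objects below are well defined. Moreover: a) if $n\ge1$, then for all $z\in\mathbb C\setminus\{a,b\}$ $$U^{(2n)}(z)=\mathcal D\Bigl(\tfrac1{(b-z)(z-a)},1\Bigr)\overrightarrow{\prod_{k=0}^{n-1}}\bigl[\mathcal U((z-a)\mathbf l_{k-1})\,\mathcal L(-\mathbf m_k)\bigr]\;\mathcal U((z-a)\mathbf l_{n-1})\;\mathcal L\Bigl(Q_{2,n-1}^{-1}(a)P_{2,n-1}(a)+\tfrac1{b-a}\Theta_{2,n}^{-1}(a)\Gamma_{2,n}(a)\Bigr)\;\mathcal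 D\Bigl((b-a)(z-a),\tfrac{b-z}{b-a}\Bigr);$$ b) for all $z\in\mathbb C$ $$U^{(2n)}(z)=\overrightarrow{\prod_{k=0}^{n-1}}\bigl[\mathcal L(-(z-a)M_k)\,\mathcal U(L_k)\bigr]\;\mathcal L(-(z-a)M_n)\;\mathcal U\Bigl(Q_{1,n}^*(a)P_{1,n}^{*^{-1}}(a)+\tfrac1{b-a}\Theta_{1,n}^*(a)\Gamma_{1,n}^{*^{-1}}(a)\Bigr).$$ (ii) Let $(s_k)_{k=0}^{2n+1}$ be Hausdorff positive definite on $[a,b]$. Then $H_{1,j},K_{1,j},K_{2,j}$ ($0\le j\le n$) and $H_{2,j}$ ($0\le j\le n-1$) are positive definite, and $Q_{2,n}(a)$, $P_{1,n+1}(a)$, $\Gamma_{1,n}(a)$, $\Theta_{2,n}(a)$ are invertible. Moreover: a) for all $z\in\mathbb C\setminus\{b\}$ $$U^{(2n+1)}(z)=\mathcal D\Bigl(\tfrac1{b-z},1\Bigr)\overrightarrow{\prod_{k=0}^{n}}\bigl[\mathcal U(\mathbf l_{k-1})\,\mathcal L(-(z-a)\mathbf m_k)\bigr]\;\mathcal U\Bigl(-\Gamma_{1,n}^{-1}(a)\Theta_{1,n}(a)-(b-a)P_{1,n+1}^{-1}(a)Q_{1,n+1}(a)\Bigr)\;\mathcal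 D(b-z,1);$$ b) for all $z\in\mathbb C\setminus\{a\}$ $$U^{(2n+1)}(z)=\mathcal D\Bigl(\tfrac1{z-a},1\Bigr)\overrightarrow{\prod_{k=0}^{n}}\bigl[\mathcal L(-M_k)\,\mathcal U((z-a)L_k)\bigr]\;\mathcal L\Bigl(-\Gamma_{2,n}^*(a)\Theta_{2,n}^{*^{-1}}(a)-(b-a)P_{2,n}^*(a)Q_{2,n}^{*^{-1}}(a)\Bigr)\;\mathcal D(z-a,1).$$ -/

import Mathlib

open scoped Matrix ComplexOrder

noncomputable section

namespace THMM

variable {q : ℕ}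

/-- The block matrix with `M × N` blocks of size `q × q`, the `(i, k)` block being `f i k`. -/
def blockMat (M N : ℕ) (f : ℕ → ℕ → Matrix (Fin q) (Fin q) ℂ) :
    Matrix (Fin M × Fin q) (Fin N × Fin q) ℂ :=
  Matrix.of fun x y => f x.1 y.1 x.2 y.2

/-- The block column with `N` blocks of size `q × q`, the `i`-th block being `f i`. -/
def blockCol (N : ℕ) (f : ℕ → Matrix (Fin q) (Fin q) ℂ) :
    Matrix (Fin N × Fin q) (Fin q) ℂ :=
  Matrix.of fun x y => f x.1 x.2 y

/-- The block Hankel matrix `{t_{i+k}}` with `N × N` blocks (the empty matrix for `N = 0`). -/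
def hankel (t : ℕ → Matrix (Fin q) (Fin q) ℂ) (N : ℕ) :
    Matrix (Fin N × Fin q) (Fin N × Fin q) ℂ :=
  blockMat N N fun i k => t (i + k)

/-- `ŝ_k = -a b s_k + (a + b) s_{k+1} - s_{k+2}`. -/
def hatSeq (a b : ℝ) (s : ℕ → Matrix (Fin q) (Fin q) ℂ) (k : ℕ) : Matrix (Fin q) (Fin q) ℂ :=
  -((a * b : ℂ) • s k) + (a + b : ℂ) • s (k + 1) - s (k + 2)

/-- `b s_k - s_{k+1}`. -/
def rightSeq (b : ℝ) (s : ℕ → Matrix (Fin q) (Fin q) ℂ) (k : ℕ) : Matrix (Fin q) (Fin q) ℂ :=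
  (b : ℂ) • s k - s (k + 1)

/-- `-a s_k + s_{k+1}`. -/
def leftSeq (a : ℝ) (s : ℕ → Matrix (Fin q) (Fin q) ℂ) (k : ℕ) : Matrix (Fin q) (Fin q) ℂ :=
  -((a : ℂ) • s k) + s (k + 1)

/-- `H_{1,N-1}`; the argument `N` is the number of block rows, here and in the next three
definitions. -/
def H1 (s : ℕ → Matrix (Fin q) (Fin q) ℂ) (N : ℕ) :
    Matrix (Fin N × Fin q) (Fin N × Fin q) ℂ :=
  hankel s N

/-- `H_{2,N-1}`. -/
def H2 (a b : ℝ) (s : ℕ → Matrix (Fin q) (Fin q) ℂ) (N : ℕ) :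
    Matrix (Fin N × Fin q) (Fin N × Fin q) ℂ :=
  hankel (hatSeq a b s) N

/-- `K_{1,N-1}`. -/
def K1 (b : ℝ) (s : ℕ → Matrix (Fin q) (Fin q) ℂ) (N : ℕ) :
    Matrix (Fin N × Fin q) (Fin N × Fin q) ℂ :=
  hankel (rightSeq b s) N

/-- `K_{2,N-1}`. -/
def K2 (a : ℝ) (s : ℕ → Matrix (Fin q) (Fin q) ℂ) (N : ℕ) :
    Matrix (Fin N × Fin q) (Fin N × Fin q) ℂ :=
  hankel (leftSeq a s) N

/-- `(s_k)_{k=0}^{2n}` is a Hausdorff positive definite sequence on `[a, b]`: `H_{1,n}` and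
`H_{2,n-1}` are positive definite. The terms `s_k` with `k > 2n` do not enter. -/
def HausdorffPosDefEven (a b : ℝ) (s : ℕ → Matrix (Fin q) (Fin q) ℂ) (n : ℕ) : Prop :=
  (H1 s (n + 1)).PosDef ∧ (H2 a b s n).PosDef

/-- `(s_k)_{k=0}^{2n+1}` is a Hausdorff positive definite sequence on `[a, b]`: `K_{1,n}` and
`K_{2,n}` are positive definite. The terms `s_k` with `k > 2n+1` do not enter. -/
def HausdorffPosDefOdd (a b : ℝ) (s : ℕ → Matrix (Fin q) (Fin q) ℂ) (n : ℕ) : Prop :=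
  (K1 b s (n + 1)).PosDef ∧ (K2 a s (n + 1)).PosDef

/-- The block shift `T_j`, with identity blocks on the first block subdiagonal. -/
def shiftT (q j : ℕ) : Matrix (Fin (j + 1) × Fin q) (Fin (j + 1) × Fin q) ℂ :=
  blockMat (j + 1) (j + 1) fun i k => if i = k + 1 then 1 else 0

/-- `R_j(z) = (I - z T_j)⁻¹`. -/
def resolvR (q j : ℕ) (z : ℂ) : Matrix (Fin (j + 1) × Fin q) (Fin (j + 1) × Fin q) ℂ :=
  (1 - z • shiftT q j)⁻¹

/-- `v_j = (I_q, 0, …, 0)ᵀ`, with `j + 1` blocks. -/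
def colV (q j : ℕ) : Matrix (Fin (j + 1) × Fin q) (Fin q) ℂ :=
  blockCol (j + 1) fun i => if i = 0 then 1 else 0

/-- `u_{1,j} = (0, -s_0, …, -s_{j-1})ᵀ`. -/
def colU1 (s : ℕ → Matrix (Fin q) (Fin q) ℂ) (j : ℕ) : Matrix (Fin (j + 1) × Fin q) (Fin q) ℂ :=
  blockCol (j + 1) fun i => match i with
    | 0 => 0
    | i + 1 => -s i

/-- `u_{2,j} = (-(a + b) s_0 + s_1, -ŝ_0, …, -ŝ_{j-1})ᵀ`. -/
def colU2 (a b : ℝ) (s : ℕ → Matrix (Fin q) (Fin q) ℂ) (j : ℕ) :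
    Matrix (Fin (j + 1) × Fin q) (Fin q) ℂ :=
  blockCol (j + 1) fun i => match i with
    | 0 => -((a + b : ℂ) • s 0) + s 1
    | i + 1 => -hatSeq a b s i

/-- `ũ_{1,j} = (s_0, s_1 - b s_0, …, s_j - b s_{j-1})ᵀ`. -/
def colUt1 (b : ℝ) (s : ℕ → Matrix (Fin q) (Fin q) ℂ) (j : ℕ) :
    Matrix (Fin (j + 1) × Fin q) (Fin q) ℂ :=
  blockCol (j + 1) fun i => match i with
    | 0 => s 0
    | i + 1 => s (i + 1) - (b : ℂ) • s i

/-- `ũ_{2,j} = (-s_0, -s_1 + a s_0, …, -s_j + a s_{j-1})ᵀ`. -/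
def colUt2 (a : ℝ) (s : ℕ → Matrix (Fin q) (Fin q) ℂ) (j : ℕ) :
    Matrix (Fin (j + 1) × Fin q) (Fin q) ℂ :=
  blockCol (j + 1) fun i => match i with
    | 0 => -s 0
    | i + 1 => -s (i + 1) + (a : ℂ) • s i

/-- The block row `(-Y* G⁻¹, I_q)` with `j + 1` blocks, where `G` is the block Hankel matrix of `t`
with `j × j` blocks and `Y = (t_j, …, t_{2j-1})ᵀ`. For `j = 0` it is `I_q`. -/
def monicRow (t : ℕ → Matrix (Fin q) (Fin q) ℂ) (j : ℕ) :
    Matrix (Fin q) (Fin (j + 1) × Fin q) ℂ :=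
  Matrix.of fun x y =>
    Fin.lastCases (motive := fun _ => ℂ)
      ((1 : Matrix (Fin q) (Fin q) ℂ) x y.2)
      (fun i => (-((blockCol j fun k => t (j + k))ᴴ * (hankel t j)⁻¹)) x (i, y.2))
      y.1

/-- `P_{1,j}(z)`. For `j = 0` this is `I_q`. -/
def P1 (s : ℕ → Matrix (Fin q) (Fin q) ℂ) (j : ℕ) (z : ℂ) : Matrix (Fin q) (Fin q) ℂ :=
  monicRow s j * resolvR q j z * colV q j

/-- `P_{2,j}(z, a, b)`. For `j = 0` this is `I_q`. -/
def P2 (a b : ℝ) (s : ℕ → Matrix (Fin q) (Fin q) ℂ) (j : ℕ) (z : ℂ) : Matrix (Fin q) (Fin q) ℂ :=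
  monicRow (hatSeq a b s) j * resolvR q j z * colV q j

/-- `Q_{1,j}(z)`. For `j = 0` this is `0`. -/
def Q1 (s : ℕ → Matrix (Fin q) (Fin q) ℂ) (j : ℕ) (z : ℂ) : Matrix (Fin q) (Fin q) ℂ :=
  -(monicRow s j * resolvR q j z * colU1 s j)

/-- `Q_{2,j}(z, a, b)`. For `j = 0` this is `-(u_{2,0} + z s_0)`. -/
def Q2 (a b : ℝ) (s : ℕ → Matrix (Fin q) (Fin q) ℂ) (j : ℕ) (z : ℂ) : Matrix (Fin q) (Fin q) ℂ :=
  -(monicRow (hatSeq a b s) j * resolvR q j z * (colU2 a b s j + z • (colV q j * s 0)))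

/-- `Γ_{1,j}(z, b)`. For `j = 0` this is `I_q`. -/
def Gamma1 (b : ℝ) (s : ℕ → Matrix (Fin q) (Fin q) ℂ) (j : ℕ) (z : ℂ) :
    Matrix (Fin q) (Fin q) ℂ :=
  monicRow (rightSeq b s) j * resolvR q j z * colV q j

/-- `Γ_{2,j}(z, a)`. For `j = 0` this is `I_q`. -/
def Gamma2 (a : ℝ) (s : ℕ → Matrix (Fin q) (Fin q) ℂ) (j : ℕ) (z : ℂ) :
    Matrix (Fin q) (Fin q) ℂ :=
  monicRow (leftSeq a s) j * resolvR q j z * colV q j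

/-- `Θ_{1,j}(z, b)`. For `j = 0` this is `s_0`. -/
def Theta1 (b : ℝ) (s : ℕ → Matrix (Fin q) (Fin q) ℂ) (j : ℕ) (z : ℂ) :
    Matrix (Fin q) (Fin q) ℂ :=
  monicRow (rightSeq b s) j * resolvR q j z * colUt1 b s j

/-- `Θ_{2,j}(z, a)`. For `j = 0` this is `-s_0`. -/
def Theta2 (a : ℝ) (s : ℕ → Matrix (Fin q) (Fin q) ℂ) (j : ℕ) (z : ℂ) :
    Matrix (Fin q) (Fin q) ℂ :=
  monicRow (leftSeq a s) j * resolvR q j z * colUt2 a s j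

/-- `F*(z̄)`, that is, the adjoint of the value of `F` at the conjugate of `z`. -/
def starConj (F : ℂ → Matrix (Fin q) (Fin q) ℂ) (z : ℂ) : Matrix (Fin q) (Fin q) ℂ :=
  (F (starRingEnd ℂ z))ᴴ

/-- The resolvent matrix `U^{(2j)}(z, a, b)`. -/
def resolventEven (a b : ℝ) (s : ℕ → Matrix (Fin q) (Fin q) ℂ) (j : ℕ) (z : ℂ) :
    Matrix (Fin q ⊕ Fin q) (Fin q ⊕ Fin q) ℂ :=
  Matrix.fromBlocks
    (starConj (Theta2 a s j) z * ((Theta2 a s j a)ᴴ)⁻¹)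
    ((1 / (b - a) : ℂ) • (starConj (Theta1 b s j) z * ((Gamma1 b s j a)ᴴ)⁻¹))
    ((z - a) • (starConj (Gamma2 a s j) z * ((Theta2 a s j a)ᴴ)⁻¹))
    (((b - z) / (b - a) : ℂ) • (starConj (Gamma1 b s j) z * ((Gamma1 b s j a)ᴴ)⁻¹))

/-- The resolvent matrix `U^{(2j+1)}(z, a, b)`. -/
def resolventOdd (a b : ℝ) (s : ℕ → Matrix (Fin q) (Fin q) ℂ) (j : ℕ) (z : ℂ) :
    Matrix (Fin q ⊕ Fin q) (Fin q ⊕ Fin q) ℂ :=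
  Matrix.fromBlocks
    (starConj (Q2 a b s j) z * ((Q2 a b s j a)ᴴ)⁻¹)
    (-(starConj (Q1 s (j + 1)) z * ((P1 s (j + 1) a)ᴴ)⁻¹))
    (-(((z - a) * (b - z)) • (starConj (P2 a b s j) z * ((Q2 a b s j a)ᴴ)⁻¹)))
    (starConj (P1 s (j + 1)) z * ((P1 s (j + 1) a)ᴴ)⁻¹)

/-- `w* R_j(a)* G⁻¹ R_j(a) w`. -/
def quadAt (a : ℝ) (j : ℕ) (G : Matrix (Fin (j + 1) × Fin q) (Fin (j + 1) × Fin q) ℂ)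
    (w : Matrix (Fin (j + 1) × Fin q) (Fin q) ℂ) : Matrix (Fin q) (Fin q) ℂ :=
  wᴴ * (resolvR q j a)ᴴ * G⁻¹ * resolvR q j a * w

/-- `(u_{2,j}* + a s_0 v_j*) R_j(a)* H_{2,j}⁻¹ R_j(a) (u_{2,j} + a v_j s_0)`; the left factor is the
adjoint of the right one because `s_0` is Hermitian for the sequences considered. -/
def lSum (a b : ℝ) (s : ℕ → Matrix (Fin q) (Fin q) ℂ) (j : ℕ) : Matrix (Fin q) (Fin q) ℂ :=
  ((colU2 a b s j)ᴴ + (a : ℂ) • (s 0 * (colV q j)ᴴ)) * (resolvR q j a)ᴴ * (H2 a b s (j + 1))⁻¹ *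
    resolvR q j a * (colU2 a b s j + (a : ℂ) • (colV q j * s 0))

/-- The parameters `𝐥_{-1}, 𝐥_0, 𝐥_1, …` with the index shifted by one: `lPar a b s k` is
`𝐥_{k-1}(a, b)`. -/
def lPar (a b : ℝ) (s : ℕ → Matrix (Fin q) (Fin q) ℂ) : ℕ → Matrix (Fin q) (Fin q) ℂ
  | 0 => s 0
  | 1 => lSum a b s 0
  | k + 2 => lSum a b s (k + 1) - lSum a b s k

/-- The parameters `𝐦_k(a, b)`. -/
def mPar (a b : ℝ) (s : ℕ → Matrix (Fin q) (Fin q) ℂ) : ℕ → Matrix (Fin q) (Fin q) ℂ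
  | 0 => quadAt a 0 (K1 b s 1) (colV q 0)
  | k + 1 => quadAt a (k + 1) (K1 b s (k + 2)) (colV q (k + 1)) -
      quadAt a k (K1 b s (k + 1)) (colV q k)

/-- The parameters `M_k(a)`. -/
def bigMPar (a : ℝ) (s : ℕ → Matrix (Fin q) (Fin q) ℂ) : ℕ → Matrix (Fin q) (Fin q) ℂ
  | 0 => (s 0)⁻¹
  | k + 1 => quadAt a (k + 1) (H1 s (k + 2)) (colV q (k + 1)) -
      quadAt a k (H1 s (k + 1)) (colV q k)

/-- The parameters `L_k(a)`. -/
def bigLPar (a : ℝ) (s : ℕ → Matrix (Fin q) (Fin q) ℂ) : ℕ → Matrix (Fin q) (Fin q) ℂ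
  | 0 => (colUt2 a s 0)ᴴ * (K2 a s 1)⁻¹ * colUt2 a s 0
  | k + 1 => quadAt a (k + 1) (K2 a s (k + 2)) (colUt2 a s (k + 1)) -
      quadAt a k (K2 a s (k + 1)) (colUt2 a s k)

/-- `[[I, X], [0, I]]`. -/
def upper (X : Matrix (Fin q) (Fin q) ℂ) : Matrix (Fin q ⊕ Fin q) (Fin q ⊕ Fin q) ℂ :=
  Matrix.fromBlocks 1 X 0 1

/-- `[[I, 0], [X, I]]`. -/
def lower (X : Matrix (Fin q) (Fin q) ℂ) : Matrix (Fin q ⊕ Fin q) (Fin q ⊕ Fin q) ℂ :=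
  Matrix.fromBlocks 1 0 X 1

/-- `[[c I, 0], [0, d I]]`. -/
def scalDiag (q : ℕ) (c d : ℂ) : Matrix (Fin q ⊕ Fin q) (Fin q ⊕ Fin q) ℂ :=
  Matrix.fromBlocks (c • 1) 0 0 (d • 1)

/-- The ordered product `A_0 A_1 ⋯ A_{N-1}`. -/
def rightProd (N : ℕ) (A : ℕ → Matrix (Fin q ⊕ Fin q) (Fin q ⊕ Fin q) ℂ) :
    Matrix (Fin q ⊕ Fin q) (Fin q ⊕ Fin q) ℂ :=
  ((List.range N).map A).prod

end THMM

end

open THMM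

/-!
All the matrix functions involved are values of left linear functionals at matrix polynomials:
`P` and `Γ` are evaluations, `Q` and `Θ` divided difference functionals, of monic orthogonal
polynomials. Multiplying by the inverse of the value at `a` turns these polynomials into the
orthogonal polynomial `p_N` with `p_N(a) = 1` and the reproducing kernel `k_N` at `a`, and turns
each resolvent matrix into a `2 × 2` block matrix that is affine in a pair of polynomials.

Two uniqueness facts hold for positive definite moments: a polynomial of degree at most `N`
orthogonal to all lower degrees is a multiple of `p_N`, and one of degree at most `N + 1` which
is orthogonal to degrees below `N` and vanishes at `a` is a multiple of `(x - a) k_{N+1}`. Hence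
`k_{N+1} - k_N` is a multiple of `p_N`, and `p_{N+1} - p_N` is a multiple of `(x - a) k_{N+1}`, the
coefficients being the Dyukarev–Stieltjes parameters; each step of the recursion is an elementary
triangular factor. The same two facts compare the polynomials of `dσ` with those of `(b - x) dσ`,
which gives the last factor of every product.
-/

noncomputable section

namespace THMM

open Polynomial

section Functional

variable {𝕜 R : Type*} [CommRing 𝕜] [Ring R] [Algebra 𝕜 R]

/-- The left linear functional with moments `w`, whose value at `F = ∑ F_i X^i` is `∑ F_i w_i`.
For `w_i = ∫ x^i dσ` this is `∫ F dσ`. -/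
def momentPair (w : ℕ → R) : R[X] →ₗ[R] R :=
  lsum fun i => LinearMap.toSpanSingleton R R (w i)

theorem momentPair_apply (w : ℕ → R) (F : R[X]) :
    momentPair w F = F.sum fun i r => r * w i := rfl

theorem momentPair_monomial (w : ℕ → R) (i : ℕ) (r : R) :
    momentPair w (monomial i r) = r * w i := by
  rw [momentPair_apply, sum_monomial_index r (fun i r => r * w i) (zero_mul _)]

theorem momentPair_one (w : ℕ → R) : momentPair w 1 = w 0 := by
  rw [← monomial_zero_one, momentPair_monomial, one_mul]

theorem momentPair_add_seq (w u : ℕ → R) (F : R[X]) :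
    momentPair (fun i => w i + u i) F = momentPair w F + momentPair u F := by
  simp only [momentPair_apply, sum_def, mul_add, Finset.sum_add_distrib]

theorem momentPair_smul_seq (c : 𝕜) (w : ℕ → R) (F : R[X]) :
    momentPair (fun i => c • w i) F = c • momentPair w F := by
  simp only [momentPair_apply, sum_def, mul_smul_comm, Finset.smul_sum]

theorem momentPair_neg_seq (w : ℕ → R) (F : R[X]) :
    momentPair (fun i => -w i) F = -momentPair w F := by
  simp only [momentPair_apply, sum_def, mul_neg, Finset.sum_neg_distrib]

theorem momentPair_mul_const (w : ℕ → R) (r : R) (F : R[X]) :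
    momentPair (fun i => w i * r) F = momentPair w F * r := by
  simp only [momentPair_apply, sum_def, Finset.sum_mul, mul_assoc]

variable (R) in
/-- The powers of a scalar `z`: the moments of the evaluation `F ↦ F(z)`. -/
def powSeq (z : 𝕜) (i : ℕ) : R := z ^ i • 1

/-- The moments `∑_{k < i} z^{i-1-k} s_k` of the divided difference functional
`F ↦ ∫ (F(x) - F(z)) / (x - z) dσ(x)`, where `s` are the moments of `σ`. -/
def divDiffSeq (s : ℕ → R) (z : 𝕜) : ℕ → R
  | 0 => 0
  | i + 1 => z • divDiffSeq s z i + s i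

/-- Multiplication of a polynomial by `X - c` for a scalar `c`. -/
def mulSub (c : 𝕜) : R[X] →ₗ[R] R[X] :=
  LinearMap.mulRight R (X - C (algebraMap 𝕜 R c))

theorem mulSub_apply (c : 𝕜) (F : R[X]) : mulSub c F = F * X - c • F := by
  rw [mulSub, LinearMap.mulRight_apply, mul_sub, ← Polynomial.algebraMap_apply, ← Algebra.commutes,
    ← Algebra.smul_def]

theorem mulSub_comm (c d : 𝕜) (F : R[X]) : mulSub c (mulSub d F) = mulSub d (mulSub c F) := by
  simp only [mulSub_apply, sub_mul, smul_sub, smul_mul_assoc, smul_comm d c]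
  abel

theorem mem_degreeLT_iff_coeff {F : R[X]} {N : ℕ} :
    F ∈ degreeLT R N ↔ ∀ m, N ≤ m → F.coeff m = 0 := by
  rw [mem_degreeLT, degree_lt_iff_coeff_zero]

theorem coeff_mulSub_succ (c : 𝕜) (F : R[X]) (m : ℕ) :
    (mulSub c F).coeff (m + 1) = F.coeff m - c • F.coeff (m + 1) := by
  rw [mulSub_apply, coeff_sub, coeff_mul_X, coeff_smul]

theorem mulSub_mem_degreeLT (c : 𝕜) {F : R[X]} {N : ℕ} (hF : F ∈ degreeLT R N) :
    mulSub c F ∈ degreeLT R (N + 1) := by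
  rw [mem_degreeLT_iff_coeff] at *
  rintro (_ | m) hm
  · omega
  · rw [coeff_mulSub_succ, hF m (by omega), hF (m + 1) (by omega), smul_zero, sub_zero]

theorem momentPair_mulSub (w : ℕ → R) (c : 𝕜) (F : R[X]) :
    momentPair w (mulSub c F) = momentPair (fun i => w (i + 1) - c • w i) F := by
  induction F using Polynomial.induction_on' with
  | add F G hF hG => rw [map_add, map_add, map_add, hF, hG]
  | monomial i r =>
    rw [mulSub_apply, monomial_mul_X, smul_monomial, map_sub]
    simp only [momentPair_monomial, mul_sub, smul_mul_assoc, mul_smul_comm]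

theorem momentPair_powSeq_mulSub (z c : 𝕜) (F : R[X]) :
    momentPair (powSeq R z) (mulSub c F) = (z - c) • momentPair (powSeq R z) F := by
  rw [momentPair_mulSub, ← momentPair_smul_seq]
  congr 2
  funext i
  rw [powSeq, powSeq, pow_succ', mul_smul, sub_smul]

theorem momentPair_divDiffSeq_mulSub (s : ℕ → R) (z c : 𝕜) (F : R[X]) :
    momentPair (divDiffSeq s z) (mulSub c F) =
      (z - c) • momentPair (divDiffSeq s z) F + momentPair s F := by
  rw [momentPair_mulSub, ← momentPair_smul_seq, ← momentPair_add_seq]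
  congr 2
  funext i
  rw [divDiffSeq, sub_smul]
  abel

theorem momentPair_powSeq_mulSub_self (z : 𝕜) (F : R[X]) :
    momentPair (powSeq R z) (mulSub z F) = 0 := by
  rw [momentPair_powSeq_mulSub, sub_self, zero_smul]

theorem momentPair_divDiffSeq_mulSub_self (s : ℕ → R) (z : 𝕜) (F : R[X]) :
    momentPair (divDiffSeq s z) (mulSub z F) = momentPair s F := by
  rw [momentPair_divDiffSeq_mulSub, sub_self, zero_smul, zero_add]

theorem momentPair_powSeq_C (z : 𝕜) (r : R) : momentPair (powSeq R z) (C r) = r := by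
  rw [← monomial_zero_left, momentPair_monomial, powSeq, pow_zero, one_smul, mul_one]

theorem exists_mulSub_add_C (c : 𝕜) {N : ℕ} {F : R[X]} (hF : F ∈ degreeLT R (N + 1)) :
    ∃ G ∈ degreeLT R N, ∃ r, mulSub c G + C r = F := by
  induction N generalizing F with
  | zero =>
    refine ⟨0, zero_mem _, F.coeff 0, ?_⟩
    rw [map_zero, zero_add, ← eq_C_of_degree_le_zero]
    exact Order.lt_succ_iff.1 (mem_degreeLT.1 hF)
  | succ N ih =>
    have hdivX : F.divX ∈ degreeLT R (N + 1) := by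
      rw [mem_degreeLT_iff_coeff] at *
      intro m hm
      rw [coeff_divX, hF (m + 1) (by omega)]
    obtain ⟨G, hG, r, hGr⟩ := ih hdivX
    refine ⟨G * X + C r, ?_, c • r + F.coeff 0, ?_⟩
    · rw [mem_degreeLT_iff_coeff] at *
      rintro (_ | m) hm
      · omega
      · rw [coeff_add, coeff_mul_X, hG m (by omega), coeff_C_succ, add_zero]
    · conv_rhs => rw [← divX_mul_X_add F, ← hGr]
      simp only [mulSub_apply, add_mul, sub_mul, smul_mul_assoc, smul_add, C_add, ← smul_C]
      abel

theorem exists_mulSub_eq {c : 𝕜} {N : ℕ} {F : R[X]} (hF : F ∈ degreeLT R (N + 1))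
    (hc : momentPair (powSeq R c) F = 0) : ∃ G ∈ degreeLT R N, mulSub c G = F := by
  obtain ⟨G, hG, r, rfl⟩ := exists_mulSub_add_C c hF
  rw [map_add, momentPair_powSeq_mulSub_self, zero_add, momentPair_powSeq_C] at hc
  exact ⟨G, hG, by rw [hc, C_0, add_zero]⟩

end Functional

/-- Complex `q × q` matrices. -/
abbrev Mat (q : ℕ) := Matrix (Fin q) (Fin q) ℂ

/-- Polynomials with `q × q` matrix coefficients. -/
abbrev MatPoly (q : ℕ) := (Mat q)[X]

variable {q : ℕ}

theorem momentPair_leftSeq_shift (a : ℝ) (s : ℕ → Mat q) (k : ℕ) (F : MatPoly q) :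
    momentPair (fun i => leftSeq a s (i + k)) F =
      momentPair (fun i => s (i + k)) (mulSub (a : ℂ) F) := by
  rw [momentPair_mulSub]
  congr 2
  funext i
  rw [leftSeq, add_right_comm]
  abel

theorem rightSeq_eq_neg_leftSeq (b : ℝ) (s : ℕ → Mat q) (k : ℕ) :
    rightSeq b s k = -leftSeq b s k := by
  rw [rightSeq, leftSeq]
  abel

theorem momentPair_rightSeq_shift (b : ℝ) (s : ℕ → Mat q) (k : ℕ) (F : MatPoly q) :
    momentPair (fun i => rightSeq b s (i + k)) F =
      -momentPair (fun i => s (i + k)) (mulSub (b : ℂ) F) := by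
  simp only [rightSeq_eq_neg_leftSeq]
  rw [momentPair_neg_seq, momentPair_leftSeq_shift]

theorem momentPair_rightSeq (b : ℝ) (s : ℕ → Mat q) (F : MatPoly q) :
    momentPair (rightSeq b s) F = -momentPair s (mulSub (b : ℂ) F) :=
  momentPair_rightSeq_shift b s 0 F

theorem divDiffSeq_rightSeq (b : ℝ) (s : ℕ → Mat q) (z : ℂ) (i : ℕ) :
    divDiffSeq (rightSeq b s) z i =
      -(divDiffSeq s z (i + 1) - (b : ℂ) • divDiffSeq s z i) + powSeq (Mat q) z i * s 0 := by
  induction i with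
  | zero => simp [divDiffSeq, powSeq]
  | succ i ih =>
    rw [divDiffSeq, ih]
    simp only [divDiffSeq, powSeq, rightSeq, smul_mul_assoc, one_mul, pow_succ']
    module

theorem momentPair_divDiffSeq_rightSeq (b : ℝ) (s : ℕ → Mat q) (z : ℂ) (F : MatPoly q) :
    momentPair (divDiffSeq (rightSeq b s) z) F =
      -momentPair (divDiffSeq s z) (mulSub (b : ℂ) F) + momentPair (powSeq (Mat q) z) F * s 0 := by
  rw [momentPair_mulSub, ← momentPair_neg_seq, ← momentPair_mul_const, ← momentPair_add_seq]
  congr 2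
  funext i
  exact divDiffSeq_rightSeq b s z i

theorem leftSeq_rightSeq (a b : ℝ) (s : ℕ → Mat q) :
    leftSeq a (rightSeq b s) = hatSeq a b s := by
  funext k
  simp only [leftSeq, rightSeq, hatSeq]
  module

/-- The block row with `N` blocks of size `q × q`, the `i`-th block being `w i`. -/
def blockRow (N : ℕ) (w : ℕ → Mat q) : Matrix (Fin q) (Fin N × Fin q) ℂ :=
  Matrix.of fun x y => w y.1 x y.2

theorem conjTranspose_blockCol {N : ℕ} {w : ℕ → Mat q} (hw : ∀ k < N, (w k).IsHermitian) :
    (blockCol N w)ᴴ = blockRow N w := by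
  ext x y
  exact congrFun₂ (hw y.1 y.1.2) x y.2

/-- The matrix polynomial whose coefficients are the blocks of a block row. -/
def rowPoly {N : ℕ} (c : Matrix (Fin q) (Fin N × Fin q) ℂ) : MatPoly q :=
  ∑ i : Fin N, monomial i (Matrix.of fun x y => c x (i, y))

theorem momentPair_rowPoly {N : ℕ} (c : Matrix (Fin q) (Fin N × Fin q) ℂ) (w : ℕ → Mat q) :
    momentPair w (rowPoly c) = c * blockCol N w := by
  rw [rowPoly, map_sum]
  ext x y
  simp [momentPair_monomial, Matrix.sum_apply, Matrix.mul_apply, Fintype.sum_prod_type, blockCol]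

theorem mul_hankel_apply {N : ℕ} (c : Matrix (Fin q) (Fin N × Fin q) ℂ) (t : ℕ → Mat q)
    (x : Fin q) (k : Fin N) (y : Fin q) :
    (c * hankel t N) x (k, y) = momentPair (fun i => t (i + k)) (rowPoly c) x y := by
  rw [momentPair_rowPoly]
  rfl

theorem coeff_rowPoly {N : ℕ} (c : Matrix (Fin q) (Fin N × Fin q) ℂ) (i : Fin N) :
    (rowPoly c).coeff i = Matrix.of fun x y => c x (i, y) := by
  simp [rowPoly, coeff_monomial, Fin.val_inj]

theorem rowPoly_mem_degreeLT {N : ℕ} (c : Matrix (Fin q) (Fin N × Fin q) ℂ) :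
    rowPoly c ∈ degreeLT (Mat q) N := by
  refine Submodule.sum_mem _ fun i _ => ?_
  rw [mem_degreeLT]
  exact (degree_monomial_le _ _).trans_lt (by exact_mod_cast i.2)

theorem rowPoly_blockRow_coeff {N : ℕ} {F : MatPoly q} (hF : F ∈ degreeLT (Mat q) N) :
    rowPoly (blockRow N F.coeff) = F := by
  ext1 m
  rcases lt_or_ge m N with hm | hm
  · exact coeff_rowPoly _ ⟨m, hm⟩
  · rw [mem_degreeLT_iff_coeff.1 (rowPoly_mem_degreeLT _) m hm, mem_degreeLT_iff_coeff.1 hF m hm]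

theorem rowPoly_zero {N : ℕ} : rowPoly (0 : Matrix (Fin q) (Fin N × Fin q) ℂ) = 0 :=
  Finset.sum_eq_zero fun i _ => (monomial (i : ℕ)).map_zero

/-- `F` is orthogonal to the powers `X^k`, `k < N`, with respect to the moments `t`. -/
def IsOrth (t : ℕ → Mat q) (N : ℕ) (F : MatPoly q) : Prop :=
  ∀ k < N, momentPair (fun i => t (i + k)) F = 0

section Orthogonality

variable {a b : ℝ} {t : ℕ → Mat q} {N : ℕ} {F G : MatPoly q}

theorem IsOrth.sub (hF : IsOrth t N F) (hG : IsOrth t N G) : IsOrth t N (F - G) :=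
  fun k hk => by rw [map_sub, hF k hk, hG k hk, sub_zero]

theorem IsOrth.smul {S : Type*} [SMulZeroClass S (Mat q)]
    [LinearMap.CompatibleSMul (MatPoly q) (Mat q) S (Mat q)] (hF : IsOrth t N F) (r : S) :
    IsOrth t N (r • F) :=
  fun k hk => by rw [LinearMap.map_smul_of_tower, hF k hk, smul_zero]

theorem isOrth_leftSeq_iff : IsOrth (leftSeq a t) N F ↔ IsOrth t N (mulSub (a : ℂ) F) := by
  simp only [IsOrth, momentPair_leftSeq_shift]

theorem isOrth_rightSeq_iff : IsOrth (rightSeq b t) N F ↔ IsOrth t N (mulSub (b : ℂ) F) := by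
  simp only [IsOrth, momentPair_rightSeq_shift, neg_eq_zero]

theorem momentPair_shift_succ (a : ℝ) (t : ℕ → Mat q) (k : ℕ) (F : MatPoly q) :
    momentPair (fun i => t (i + (k + 1))) F =
      momentPair (fun i => leftSeq a t (i + k)) F +
        (a : ℂ) • momentPair (fun i => t (i + k)) F := by
  rw [← momentPair_smul_seq, ← momentPair_add_seq]
  congr 2
  funext i
  rw [leftSeq, add_assoc]
  abel

theorem IsOrth.succ_of_leftSeq (hF : IsOrth (leftSeq a t) N F) (h0 : momentPair t F = 0) :
    IsOrth t (N + 1) F := by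
  intro k
  induction k with
  | zero => exact fun _ => h0
  | succ k ih =>
    intro hk
    rw [momentPair_shift_succ a, hF k (by omega), ih (by omega), smul_zero, add_zero]

theorem IsOrth.eq_zero (ht : IsUnit (hankel t N)) (h : IsOrth t N F)
    (hF : F ∈ degreeLT (Mat q) N) : F = 0 := by
  rw [← rowPoly_blockRow_coeff hF] at h ⊢
  have hmul : blockRow N F.coeff * hankel t N = 0 := by
    ext x ⟨k, y⟩
    rw [mul_hankel_apply, h k k.2]
    rfl
  have hrow : blockRow N F.coeff = 0 := by
    rw [← Matrix.mul_nonsing_inv_cancel_right _ (blockRow N F.coeff)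
      ((Matrix.isUnit_iff_isUnit_det _).1 ht), hmul, Matrix.zero_mul]
  rw [hrow, rowPoly_zero]

end Orthogonality

section ReproducingPolynomials

/-- The matrix polynomial of degree less than `N` representing, with respect to the moments `g`,
the functional with moments `w`. -/
def reprPoly (g : ℕ → Mat q) (N : ℕ) (w : ℕ → Mat q) : MatPoly q :=
  rowPoly (blockRow N w * (hankel g N)⁻¹)

variable {g : ℕ → Mat q} {N : ℕ}

theorem reprPoly_zero (g w : ℕ → Mat q) : reprPoly g 0 w = 0 := rfl

theorem reprPoly_mem_degreeLT (g w : ℕ → Mat q) (N : ℕ) :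
    reprPoly g N w ∈ degreeLT (Mat q) N :=
  rowPoly_mem_degreeLT _

theorem momentPair_reprPoly (g w u : ℕ → Mat q) (N : ℕ) :
    momentPair u (reprPoly g N w) = blockRow N w * (hankel g N)⁻¹ * blockCol N u :=
  momentPair_rowPoly _ _

theorem momentPair_shift_reprPoly (hg : IsUnit (hankel g N)) (w : ℕ → Mat q) {k : ℕ}
    (hk : k < N) : momentPair (fun i => g (i + k)) (reprPoly g N w) = w k := by
  ext x y
  rw [reprPoly, ← mul_hankel_apply _ g x ⟨k, hk⟩,
    Matrix.nonsing_inv_mul_cancel_right _ _ ((Matrix.isUnit_iff_isUnit_det _).1 hg)]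
  rfl

theorem isHermitian_momentPair_reprPoly (hg : (hankel g N).IsHermitian) {w : ℕ → Mat q}
    (hw : ∀ k < N, (w k).IsHermitian) : (momentPair w (reprPoly g N w)).IsHermitian := by
  rw [momentPair_reprPoly, ← conjTranspose_blockCol hw]
  exact Matrix.isHermitian_conjTranspose_mul_mul _ hg.inv

/-- The reproducing kernel at `a` of the polynomials of degree less than `N`, with respect to the
moments `t`: it represents the evaluation at `a`. -/
def kernelPoly (a : ℝ) (t : ℕ → Mat q) (N : ℕ) : MatPoly q :=
  reprPoly t N (powSeq (Mat q) (a : ℂ))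

/-- The matrix polynomial of degree less than `N` that represents the functional with moments `t`
with respect to the moments `leftSeq a t`. -/
def markovPoly (a : ℝ) (t : ℕ → Mat q) (N : ℕ) : MatPoly q :=
  reprPoly (leftSeq a t) N t

/-- The orthogonal polynomial of degree `N` with respect to the moments `t`, normalized by the value
`1` at `a`. -/
def unitPoly (a : ℝ) (t : ℕ → Mat q) (N : ℕ) : MatPoly q :=
  1 - mulSub (a : ℂ) (markovPoly a t N)

/-- The value of the reproducing kernel on the diagonal at `a`. -/
def kernelValue (a : ℝ) (t : ℕ → Mat q) (N : ℕ) : Mat q :=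
  momentPair (powSeq (Mat q) (a : ℂ)) (kernelPoly a t N)

/-- The integral of `markovPoly`. If `t` are the moments of `σ`, it is the quadrature
approximation to `∫ (x - a)⁻¹ dσ(x)` built on the moments of `(x - a) dσ(x)`. -/
def markovValue (a : ℝ) (t : ℕ → Mat q) (N : ℕ) : Mat q :=
  momentPair t (markovPoly a t N)

end ReproducingPolynomials

section OrthogonalPolynomials

variable {a : ℝ} {t : ℕ → Mat q} {N : ℕ} {F : MatPoly q}

theorem kernelPoly_mem_degreeLT (a : ℝ) (t : ℕ → Mat q) (N : ℕ) :
    kernelPoly a t N ∈ degreeLT (Mat q) N :=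
  reprPoly_mem_degreeLT _ _ _

theorem unitPoly_mem_degreeLT (a : ℝ) (t : ℕ → Mat q) (N : ℕ) :
    unitPoly a t N ∈ degreeLT (Mat q) (N + 1) := by
  refine Submodule.sub_mem _ ?_ (mulSub_mem_degreeLT _ (reprPoly_mem_degreeLT _ _ _))
  exact mem_degreeLT.2 (degree_one_le.trans_lt (by exact_mod_cast N.succ_pos))

theorem kernelPoly_zero (a : ℝ) (t : ℕ → Mat q) : kernelPoly a t 0 = 0 :=
  reprPoly_zero _ _

theorem unitPoly_zero (a : ℝ) (t : ℕ → Mat q) : unitPoly a t 0 = 1 := by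
  rw [unitPoly, markovPoly, reprPoly_zero, map_zero, sub_zero]

theorem kernelValue_zero (a : ℝ) (t : ℕ → Mat q) : kernelValue a t 0 = 0 := by
  rw [kernelValue, kernelPoly_zero, map_zero]

theorem markovValue_zero (a : ℝ) (t : ℕ → Mat q) : markovValue a t 0 = 0 := by
  rw [markovValue, markovPoly, reprPoly_zero, map_zero]

theorem momentPair_shift_kernelPoly (ht : IsUnit (hankel t N)) {k : ℕ} (hk : k < N) :
    momentPair (fun i => t (i + k)) (kernelPoly a t N) = powSeq (Mat q) (a : ℂ) k :=
  momentPair_shift_reprPoly ht _ hk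

theorem momentPair_kernelPoly (ht : IsUnit (hankel t (N + 1))) :
    momentPair t (kernelPoly a t (N + 1)) = 1 := by
  have h := momentPair_shift_kernelPoly (a := a) ht N.succ_pos
  rwa [powSeq, pow_zero, one_smul] at h

theorem isOrth_kernelPoly (ht : IsUnit (hankel t (N + 1))) :
    IsOrth (leftSeq a t) N (kernelPoly a t (N + 1)) := by
  intro k hk
  rw [← add_eq_right, ← momentPair_shift_succ, momentPair_shift_kernelPoly ht (by omega),
    momentPair_shift_kernelPoly ht (by omega), powSeq, powSeq, pow_succ', mul_smul]

theorem isOrth_unitPoly (ht : IsUnit (hankel (leftSeq a t) N)) : IsOrth t N (unitPoly a t N) := by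
  intro k hk
  rw [unitPoly, map_sub, ← momentPair_leftSeq_shift, markovPoly, momentPair_shift_reprPoly ht _ hk,
    momentPair_one, zero_add, sub_self]

theorem momentPair_unitPoly (ht : IsUnit (hankel (leftSeq a t) (N + 1))) :
    momentPair t (unitPoly a t (N + 1)) = 0 :=
  isOrth_unitPoly ht 0 N.succ_pos

theorem momentPair_powSeq_unitPoly (a : ℝ) (t : ℕ → Mat q) (N : ℕ) :
    momentPair (powSeq (Mat q) (a : ℂ)) (unitPoly a t N) = 1 := by
  rw [unitPoly, map_sub, momentPair_powSeq_mulSub_self, momentPair_one, sub_zero, powSeq, pow_zero,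
    one_smul]

theorem momentPair_divDiffSeq_unitPoly (a : ℝ) (t : ℕ → Mat q) (N : ℕ) :
    momentPair (divDiffSeq t (a : ℂ)) (unitPoly a t N) = -markovValue a t N := by
  rw [unitPoly, map_sub, momentPair_divDiffSeq_mulSub_self, momentPair_one, divDiffSeq, zero_sub,
    markovValue]

theorem IsOrth.eq_smul_unitPoly (ht : IsUnit (hankel (leftSeq a t) N)) (h : IsOrth t N F)
    (hF : F ∈ degreeLT (Mat q) (N + 1)) :
    F = momentPair (powSeq (Mat q) (a : ℂ)) F • unitPoly a t N := by
  obtain ⟨G, hG, hGF⟩ : ∃ G ∈ degreeLT (Mat q) N, mulSub (a : ℂ) G =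
      F - momentPair (powSeq (Mat q) (a : ℂ)) F • unitPoly a t N := by
    refine exists_mulSub_eq (Submodule.sub_mem _ hF
      (Submodule.smul_mem _ _ (unitPoly_mem_degreeLT a t N))) ?_
    rw [map_sub, map_smul, momentPair_powSeq_unitPoly, smul_eq_mul, mul_one, sub_self]
  have hG_orth : IsOrth (leftSeq a t) N G := by
    rw [isOrth_leftSeq_iff, hGF]
    exact h.sub ((isOrth_unitPoly ht).smul _)
  rw [← sub_eq_zero, ← hGF, hG_orth.eq_zero ht hG, map_zero]

theorem IsOrth.eq_smul_kernelPoly (ht : IsUnit (hankel t (N + 1))) (h : IsOrth (leftSeq a t) N F)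
    (hF : F ∈ degreeLT (Mat q) (N + 1)) : F = momentPair t F • kernelPoly a t (N + 1) := by
  rw [← sub_eq_zero]
  refine IsOrth.eq_zero ht ((h.sub ((isOrth_kernelPoly ht).smul _)).succ_of_leftSeq ?_) ?_
  · rw [map_sub, map_smul, momentPair_kernelPoly ht, smul_eq_mul, mul_one, sub_self]
  · exact Submodule.sub_mem _ hF (Submodule.smul_mem _ _ (kernelPoly_mem_degreeLT a t _))

theorem IsOrth.eq_smul_mulSub_kernelPoly (ht : IsUnit (hankel t (N + 1))) (h : IsOrth t N F)
    (hF : F ∈ degreeLT (Mat q) (N + 2)) (ha : momentPair (powSeq (Mat q) (a : ℂ)) F = 0) :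
    F = momentPair (divDiffSeq t (a : ℂ)) F • mulSub (a : ℂ) (kernelPoly a t (N + 1)) := by
  obtain ⟨G, hG, rfl⟩ := exists_mulSub_eq hF ha
  rw [momentPair_divDiffSeq_mulSub_self, ← map_smul,
    ← (isOrth_leftSeq_iff.2 h).eq_smul_kernelPoly ht hG]

theorem kernelPoly_succ (ht : IsUnit (hankel t N)) (ht' : IsUnit (hankel t (N + 1)))
    (hl : IsUnit (hankel (leftSeq a t) N)) :
    kernelPoly a t (N + 1) =
      kernelPoly a t N + (kernelValue a t (N + 1) - kernelValue a t N) • unitPoly a t N := by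
  rw [kernelValue, kernelValue, ← map_sub, ← sub_eq_iff_eq_add']
  refine IsOrth.eq_smul_unitPoly hl (fun k hk => ?_) (Submodule.sub_mem _
    (kernelPoly_mem_degreeLT _ _ _) (degreeLT_mono N.le_succ (kernelPoly_mem_degreeLT _ _ _)))
  rw [map_sub, momentPair_shift_kernelPoly ht hk, momentPair_shift_kernelPoly ht' (by omega),
    sub_self]

theorem unitPoly_succ (ht : IsUnit (hankel t (N + 1))) (hl : IsUnit (hankel (leftSeq a t) N))
    (hl' : IsUnit (hankel (leftSeq a t) (N + 1))) :
    unitPoly a t (N + 1) = unitPoly a t N -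
      (markovValue a t (N + 1) - markovValue a t N) • mulSub (a : ℂ) (kernelPoly a t (N + 1)) := by
  have horth : IsOrth t N (unitPoly a t (N + 1) - unitPoly a t N) :=
    IsOrth.sub (fun k hk => isOrth_unitPoly hl' k (by omega)) (isOrth_unitPoly hl)
  have hdeg : unitPoly a t (N + 1) - unitPoly a t N ∈ degreeLT (Mat q) (N + 2) :=
    Submodule.sub_mem _ (unitPoly_mem_degreeLT _ _ _)
      (degreeLT_mono (Nat.le_succ _) (unitPoly_mem_degreeLT _ _ _))
  have h := horth.eq_smul_mulSub_kernelPoly ht hdeg (by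
    rw [map_sub, momentPair_powSeq_unitPoly, momentPair_powSeq_unitPoly, sub_self])
  rw [map_sub, momentPair_divDiffSeq_unitPoly, momentPair_divDiffSeq_unitPoly] at h
  rw [sub_eq_iff_eq_add'.1 h, sub_eq_add_neg (unitPoly a t N), ← neg_smul]
  congr 2
  abel

end OrthogonalPolynomials

section MonicPolynomials

variable {a : ℝ} {t : ℕ → Mat q} {N : ℕ}

/-- The monic orthogonal polynomial of degree `N` with respect to the moments `t`. -/
def monicPoly (t : ℕ → Mat q) (N : ℕ) : MatPoly q :=
  rowPoly (monicRow t N)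

theorem monicPoly_mem_degreeLT (t : ℕ → Mat q) (N : ℕ) :
    monicPoly t N ∈ degreeLT (Mat q) (N + 1) :=
  rowPoly_mem_degreeLT _

theorem coeff_monicPoly (t : ℕ → Mat q) (N : ℕ) : (monicPoly t N).coeff N = 1 := by
  have h := coeff_rowPoly (monicRow t N) (Fin.last N)
  rw [Fin.val_last] at h
  rw [monicPoly, h]
  ext x y
  simp [monicRow]

theorem monicPoly_eq_monomial_sub_reprPoly (hs : ∀ k < N, (t (N + k)).IsHermitian) :
    monicPoly t N = monomial N 1 - reprPoly t N fun k => t (N + k) := by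
  rw [monicPoly, rowPoly, Fin.sum_univ_castSucc, reprPoly, rowPoly, sub_eq_neg_add,
    ← Finset.sum_neg_distrib, ← conjTranspose_blockCol hs]
  congr 1
  · refine Finset.sum_congr rfl fun i _ => ?_
    rw [← monomial_neg]
    congr 1
    ext x y
    simp [monicRow]
  · rw [Fin.val_last]
    congr 1
    ext x y
    simp [monicRow]

theorem isOrth_monicPoly (ht : IsUnit (hankel t N)) (hs : ∀ k < N, (t (N + k)).IsHermitian) :
    IsOrth t N (monicPoly t N) := by
  intro k hk
  rw [monicPoly_eq_monomial_sub_reprPoly hs, map_sub, momentPair_monomial,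
    momentPair_shift_reprPoly ht _ hk, one_mul, sub_self]

theorem isUnit_of_eq_smul {A : Mat q} {F G : MatPoly q} {m : ℕ} (hF : F.coeff m = 1)
    (h : F = A • G) : IsUnit A := by
  refine IsUnit.of_mul_eq_one (G.coeff m) ?_
  rw [← smul_eq_mul, ← coeff_smul, ← h, hF]

theorem inv_smul_eq_of_eq_smul {A : Mat q} {F G : MatPoly q} {m : ℕ} (hF : F.coeff m = 1)
    (h : F = A • G) : A⁻¹ • F = G := by
  have hA := (Matrix.isUnit_iff_isUnit_det _).1 (isUnit_of_eq_smul hF h)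
  rw [h, smul_smul, Matrix.nonsing_inv_mul _ hA, one_smul]

end MonicPolynomials

section Positivity

variable {a b c : ℝ} {s t : ℕ → Mat q} {N : ℕ}

theorem posDef_hankel_of_le {j : ℕ} (h : (hankel t N).PosDef) (hj : j ≤ N) :
    (hankel t j).PosDef :=
  h.submatrix (e := Prod.map (Fin.castLE hj) id)
    ((Fin.castLE_injective hj).prodMap Function.injective_id)

theorem isHermitian_of_posDef_hankel (h : (hankel t (N + 1)).PosDef) {k : ℕ} (hk : k ≤ 2 * N) :
    (t k).IsHermitian := by
  ext x y
  have hentry := congrFun₂ h.isHermitian ((⟨min k N, by omega⟩ : Fin (N + 1)), x)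
    ((⟨k - min k N, by omega⟩ : Fin (N + 1)), y)
  rw [Matrix.conjTranspose_apply] at hentry ⊢
  simp only [hankel, blockMat, Matrix.of_apply] at hentry
  rwa [Nat.sub_add_cancel (min_le_left k N), Nat.add_sub_cancel' (min_le_left k N)] at hentry

theorem isHermitian_leftSeq {k : ℕ} (h : (t k).IsHermitian) (h' : (t (k + 1)).IsHermitian) :
    (leftSeq a t k).IsHermitian :=
  ((IsSelfAdjoint.smul (Complex.conj_ofReal a) h).neg).add h'

theorem isHermitian_rightSeq {k : ℕ} (h : (t k).IsHermitian) (h' : (t (k + 1)).IsHermitian) :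
    (rightSeq b t k).IsHermitian := by
  rw [rightSeq_eq_neg_leftSeq]
  exact (isHermitian_leftSeq h h').neg

theorem isHermitian_of_posDef_hankel_leftSeq (h : (hankel t N).PosDef)
    (hl : (hankel (leftSeq a t) N).PosDef) {k : ℕ} (hk : k < 2 * N) : (t k).IsHermitian := by
  obtain ⟨M, rfl⟩ := Nat.exists_eq_succ_of_ne_zero (n := N) (by omega)
  rcases (show k ≤ 2 * M ∨ k = 2 * M + 1 by omega) with hk | rfl
  · exact isHermitian_of_posDef_hankel h hk
  · have hsum : t (2 * M + 1) = leftSeq a t (2 * M) + (a : ℂ) • t (2 * M) := by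
      rw [leftSeq]
      abel
    rw [hsum]
    exact (isHermitian_of_posDef_hankel hl le_rfl).add
      (IsSelfAdjoint.smul (Complex.conj_ofReal a) (isHermitian_of_posDef_hankel h le_rfl))

/-- The matrix of the multiplication by `X - c` from polynomials of degree less than `N` to
polynomials of degree less than `N + 1`, acting on block columns of coefficients. -/
def mulSubMat (q : ℕ) (c : ℝ) (N : ℕ) : Matrix (Fin (N + 1) × Fin q) (Fin N × Fin q) ℂ :=
  Matrix.of fun x y =>
    (1 : Matrix _ _ ℂ) x (y.1.succ, y.2) - c * (1 : Matrix _ _ ℂ) x (y.1.castSucc, y.2)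

theorem mul_mulSubMat_apply {κ : Type*} (c : ℝ) (N : ℕ)
    (A : Matrix κ (Fin (N + 1) × Fin q) ℂ) (x : κ) (k : Fin N) (y : Fin q) :
    (A * mulSubMat q c N) x (k, y) = A x (k.succ, y) - c * A x (k.castSucc, y) := by
  simp [mulSubMat, Matrix.mul_apply, Matrix.one_apply, mul_sub, Finset.sum_sub_distrib, mul_comm]

theorem conjTranspose_mulSubMat_mul_apply {κ : Type*} (c : ℝ) (N : ℕ)
    (A : Matrix (Fin (N + 1) × Fin q) κ ℂ) (x : κ) (k : Fin N) (y : Fin q) :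
    ((mulSubMat q c N)ᴴ * A) (k, y) x = A (k.succ, y) x - c * A (k.castSucc, y) x := by
  rw [← Matrix.conjTranspose_conjTranspose A, ← Matrix.conjTranspose_mul,
    Matrix.conjTranspose_apply, mul_mulSubMat_apply]
  simp

theorem conjTranspose_mulSubMat_mul_hankel_mul (c : ℝ) (N : ℕ) (t : ℕ → Mat q) :
    (mulSubMat q c N)ᴴ * hankel t (N + 1) * mulSubMat q c N =
      hankel (leftSeq c (leftSeq c t)) N := by
  ext ⟨i, x⟩ ⟨k, y⟩
  rw [mul_mulSubMat_apply, conjTranspose_mulSubMat_mul_apply, conjTranspose_mulSubMat_mul_apply]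
  simp only [hankel, blockMat, leftSeq, Matrix.of_apply, Fin.val_succ, Fin.val_castSucc,
    Matrix.add_apply, Matrix.neg_apply, Matrix.smul_apply, smul_eq_mul]
  rw [show (i : ℕ) + 1 + (k + 1) = i + k + 1 + 1 by ring, ← add_assoc, add_right_comm (i : ℕ) 1 k]
  ring

theorem mulVec_mulSubMat_injective (c : ℝ) (N : ℕ) :
    Function.Injective (mulSubMat q c N).mulVec := by
  set L := blockMat (q := q) N (N + 1) fun m i => if m < i then (c : ℂ) ^ (i - 1 - m) • 1 else 0
    with hL
  have hinv : L * mulSubMat q c N = 1 := by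
    ext ⟨m, x⟩ ⟨k, y⟩
    rw [mul_mulSubMat_apply]
    simp only [hL, blockMat, Matrix.of_apply, Fin.val_succ, Fin.val_castSucc, Nat.add_sub_cancel]
    rcases lt_trichotomy m k with hk | rfl | hk
    · rw [if_pos (by omega), if_pos (by omega), show (k : ℕ) - m = (k - 1 - m) + 1 by omega]
      simp [pow_succ', hk.ne, mul_assoc]
    · simp [Matrix.one_apply]
    · rw [if_neg (by omega), if_neg (by omega)]
      simp [hk.ne']
  exact Function.LeftInverse.injective (g := L.mulVec) fun v => by
    rw [Matrix.mulVec_mulVec, hinv, Matrix.one_mulVec]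

theorem posDef_hankel_leftSeq_leftSeq (h : (hankel t (N + 1)).PosDef) (c : ℝ) :
    (hankel (leftSeq c (leftSeq c t)) N).PosDef := by
  rw [← conjTranspose_mulSubMat_mul_hankel_mul]
  exact h.conjTranspose_mul_mul_same (mulVec_mulSubMat_injective c N)

theorem posDef_hankel_of_smul_eq_add {u v : ℕ → Mat q} (hc : 0 < c)
    (h : ∀ k, (c : ℂ) • t k = u k + v k) (hu : (hankel u N).PosDef) (hv : (hankel v N).PosDef) :
    (hankel t N).PosDef := by
  have hsum : (c : ℂ) • hankel t N = hankel u N + hankel v N := by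
    ext x y
    exact congrFun₂ (h (x.1 + y.1)) x.2 y.2
  have hc' : (c : ℂ) ≠ 0 := by exact_mod_cast hc.ne'
  rw [← inv_smul_smul₀ hc' (hankel t N), hsum]
  exact (hu.add hv).smul (inv_pos.2 (by exact_mod_cast hc))

end Positivity

section ShiftResolvent

theorem shiftT_mul_zero {κ : Type*} (j : ℕ) (A : Matrix (Fin (j + 1) × Fin q) κ ℂ) (x : Fin q)
    (y : κ) : (shiftT q j * A) (0, x) y = 0 := by
  rw [Matrix.mul_apply]
  exact Finset.sum_eq_zero fun k _ => by simp [shiftT, blockMat]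

theorem shiftT_mul_succ {κ : Type*} (j : ℕ) (A : Matrix (Fin (j + 1) × Fin q) κ ℂ) (i : Fin j)
    (x : Fin q) (y : κ) : (shiftT q j * A) (i.succ, x) y = A (i.castSucc, x) y := by
  have hentry (k : Fin (j + 1)) (x' : Fin q) : shiftT q j (i.succ, x) (k, x') =
      (1 : Matrix (Fin (j + 1) × Fin q) (Fin (j + 1) × Fin q) ℂ) (i.castSucc, x) (k, x') := by
    by_cases hk : i.castSucc = k
    · subst hk
      simp [shiftT, blockMat, Matrix.one_apply]
    · have hk' : (i : ℕ) ≠ k := fun h => hk (Fin.ext h)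
      simp [shiftT, blockMat, hk, hk']
  conv_rhs => rw [← Matrix.one_mul A]
  simp only [Matrix.mul_apply, hentry]

theorem shiftT_pow_apply_of_lt {j m : ℕ} {i : Fin (j + 1)} (hi : i < m) (x : Fin q)
    (y : Fin (j + 1) × Fin q) : (shiftT q j ^ m) (i, x) y = 0 := by
  induction m generalizing i with
  | zero => omega
  | succ m ih =>
    rw [pow_succ']
    induction i using Fin.cases with
    | zero => exact shiftT_mul_zero j _ x y
    | succ i =>
      rw [shiftT_mul_succ]
      exact ih (by simpa using hi)

theorem isNilpotent_shiftT (q j : ℕ) : IsNilpotent (shiftT q j) :=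
  ⟨j + 1, by ext ⟨i, x⟩ y; exact shiftT_pow_apply_of_lt i.2 x y⟩

theorem resolvR_mul_blockCol (j : ℕ) (z : ℂ) {x y : ℕ → Mat q} (h0 : y 0 = x 0)
    (hsucc : ∀ i, y (i + 1) = z • y i + x (i + 1)) :
    resolvR q j z * blockCol (j + 1) x = blockCol (j + 1) y := by
  have hx : blockCol (j + 1) x = (1 - z • shiftT q j) * blockCol (j + 1) y := by
    ext ⟨i, r⟩ c
    rw [Matrix.sub_mul, Matrix.one_mul, Matrix.smul_mul, Matrix.sub_apply, Matrix.smul_apply]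
    induction i using Fin.cases with
    | zero => rw [shiftT_mul_zero]; simp [blockCol, h0]
    | succ i => rw [shiftT_mul_succ]; simp [blockCol, hsucc]
  have hunit : IsUnit (1 - z • shiftT q j) := ((isNilpotent_shiftT q j).smul z).isUnit_one_sub
  rw [hx, resolvR, Matrix.nonsing_inv_mul_cancel_left _ _
    ((Matrix.isUnit_iff_isUnit_det _).1 hunit)]

theorem resolvR_mul_colV (j : ℕ) (z : ℂ) :
    resolvR q j z * colV q j = blockCol (j + 1) (powSeq (Mat q) z) :=
  resolvR_mul_blockCol j z (by simp [powSeq]) fun i => by simp [powSeq, pow_succ', mul_smul]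

theorem resolvR_mul_colU1 (s : ℕ → Mat q) (j : ℕ) (z : ℂ) :
    resolvR q j z * colU1 s j = blockCol (j + 1) fun i => -divDiffSeq s z i :=
  resolvR_mul_blockCol j z (by simp [divDiffSeq]) fun i => by
    simp only [divDiffSeq]
    module

theorem resolvR_mul_colU2 (a b : ℝ) (s : ℕ → Mat q) (j : ℕ) (z : ℂ) :
    resolvR q j z * (colU2 a b s j + z • (colV q j * s 0)) =
      blockCol (j + 1) fun i =>
        (divDiffSeq s z (i + 1 + 1) - (b : ℂ) • divDiffSeq s z (i + 1)) -
          (a : ℂ) • (divDiffSeq s z (i + 1) - (b : ℂ) • divDiffSeq s z i) := by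
  have hcol : colU2 a b s j + z • (colV q j * s 0) = blockCol (j + 1) fun i => match i with
      | 0 => -((a + b : ℂ) • s 0) + s 1 + z • s 0
      | i + 1 => -hatSeq a b s i := by
    ext ⟨i, r⟩ c
    induction i using Fin.cases with
    | zero => simp [colU2, blockCol, colV, Matrix.mul_apply, Matrix.one_apply]
    | succ i => simp [colU2, blockCol, colV, Matrix.mul_apply]
  rw [hcol]
  refine resolvR_mul_blockCol j z ?_ fun i => ?_
  · simp only [divDiffSeq, smul_zero, zero_add]
    module
  · simp only [divDiffSeq, hatSeq]
    module

theorem resolvR_mul_colUt1 (b : ℝ) (s : ℕ → Mat q) (j : ℕ) (z : ℂ) :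
    resolvR q j z * colUt1 b s j =
      blockCol (j + 1) fun i => divDiffSeq s z (i + 1) - (b : ℂ) • divDiffSeq s z i :=
  resolvR_mul_blockCol j z (by simp [divDiffSeq]) fun i => by
    simp only [divDiffSeq]
    module

theorem resolvR_mul_colUt2 (a : ℝ) (s : ℕ → Mat q) (j : ℕ) (z : ℂ) :
    resolvR q j z * colUt2 a s j =
      blockCol (j + 1) fun i => -(divDiffSeq s z (i + 1) - (a : ℂ) • divDiffSeq s z i) :=
  resolvR_mul_blockCol j z (by simp [divDiffSeq]) fun i => by
    simp only [divDiffSeq]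
    module

theorem P1_eq (s : ℕ → Mat q) (j : ℕ) (z : ℂ) :
    P1 s j z = momentPair (powSeq (Mat q) z) (monicPoly s j) := by
  rw [P1, Matrix.mul_assoc, resolvR_mul_colV, monicPoly, momentPair_rowPoly]

theorem P2_eq (a b : ℝ) (s : ℕ → Mat q) (j : ℕ) (z : ℂ) :
    P2 a b s j z = momentPair (powSeq (Mat q) z) (monicPoly (hatSeq a b s) j) :=
  P1_eq _ _ _

theorem Gamma2_eq (a : ℝ) (s : ℕ → Mat q) (j : ℕ) (z : ℂ) :
    Gamma2 a s j z = momentPair (powSeq (Mat q) z) (monicPoly (leftSeq a s) j) :=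
  P1_eq _ _ _

theorem Q1_eq (s : ℕ → Mat q) (j : ℕ) (z : ℂ) :
    Q1 s j z = momentPair (divDiffSeq s z) (monicPoly s j) := by
  rw [Q1, Matrix.mul_assoc, resolvR_mul_colU1, ← momentPair_rowPoly, momentPair_neg_seq, neg_neg,
    monicPoly]

theorem Q2_eq (a b : ℝ) (s : ℕ → Mat q) (j : ℕ) (z : ℂ) :
    Q2 a b s j z = -momentPair (divDiffSeq s z)
      (mulSub (b : ℂ) (mulSub (a : ℂ) (monicPoly (hatSeq a b s) j))) := by
  rw [Q2, Matrix.mul_assoc, resolvR_mul_colU2, ← momentPair_rowPoly, momentPair_mulSub,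
    momentPair_mulSub, monicPoly]

theorem Theta1_eq (b : ℝ) (s : ℕ → Mat q) (j : ℕ) (z : ℂ) :
    Theta1 b s j z =
      momentPair (divDiffSeq s z) (mulSub (b : ℂ) (monicPoly (rightSeq b s) j)) := by
  rw [Theta1, Matrix.mul_assoc, resolvR_mul_colUt1, ← momentPair_rowPoly, momentPair_mulSub,
    monicPoly]

theorem Theta2_eq (a : ℝ) (s : ℕ → Mat q) (j : ℕ) (z : ℂ) :
    Theta2 a s j z =
      -momentPair (divDiffSeq s z) (mulSub (a : ℂ) (monicPoly (leftSeq a s) j)) := by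
  rw [Theta2, Matrix.mul_assoc, resolvR_mul_colUt2, ← momentPair_rowPoly, momentPair_mulSub,
    momentPair_neg_seq, monicPoly]

theorem Theta2_self (a : ℝ) (s : ℕ → Mat q) (j : ℕ) :
    Theta2 a s j a = -momentPair s (monicPoly (leftSeq a s) j) := by
  rw [Theta2_eq, momentPair_divDiffSeq_mulSub_self]

theorem Q2_self (a b : ℝ) (s : ℕ → Mat q) (j : ℕ) :
    Q2 a b s j a = momentPair (rightSeq b s) (monicPoly (hatSeq a b s) j) := by
  rw [Q2_eq, mulSub_comm, momentPair_divDiffSeq_mulSub_self, momentPair_rightSeq]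

end ShiftResolvent

section Normalization

variable {a b : ℝ} {s : ℕ → Mat q} {N : ℕ}

theorem monicPoly_eq_smul_unitPoly (hs : (hankel s N).PosDef)
    (hl : (hankel (leftSeq a s) N).PosDef) : monicPoly s N = P1 s N a • unitPoly a s N := by
  have horth : IsOrth s N (monicPoly s N) :=
    isOrth_monicPoly hs.isUnit fun _ _ => isHermitian_of_posDef_hankel_leftSeq hs hl (by omega)
  rw [P1_eq]
  exact horth.eq_smul_unitPoly hl.isUnit (monicPoly_mem_degreeLT s N)

theorem monicPoly_leftSeq_eq_smul_kernelPoly (hs : (hankel s (N + 1)).PosDef)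
    (hl : (hankel (leftSeq a s) N).PosDef) :
    monicPoly (leftSeq a s) N =
      momentPair s (monicPoly (leftSeq a s) N) • kernelPoly a s (N + 1) := by
  have hherm : ∀ k < N, (leftSeq a s (N + k)).IsHermitian := fun _ _ =>
    isHermitian_leftSeq (isHermitian_of_posDef_hankel hs (by omega))
      (isHermitian_of_posDef_hankel hs (by omega))
  exact (isOrth_monicPoly hl.isUnit hherm).eq_smul_kernelPoly hs.isUnit
    (monicPoly_mem_degreeLT _ N)

theorem isUnit_P1 (hs : (hankel s N).PosDef) (hl : (hankel (leftSeq a s) N).PosDef) :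
    IsUnit (P1 s N a) :=
  isUnit_of_eq_smul (coeff_monicPoly s N) (monicPoly_eq_smul_unitPoly hs hl)

theorem P1_inv_smul_monicPoly (hs : (hankel s N).PosDef) (hl : (hankel (leftSeq a s) N).PosDef) :
    (P1 s N a)⁻¹ • monicPoly s N = unitPoly a s N :=
  inv_smul_eq_of_eq_smul (coeff_monicPoly s N) (monicPoly_eq_smul_unitPoly hs hl)

theorem isUnit_Gamma1 (hr : (hankel (rightSeq b s) N).PosDef)
    (hh : (hankel (hatSeq a b s) N).PosDef) : IsUnit (Gamma1 b s N a) :=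
  isUnit_P1 hr (by rwa [leftSeq_rightSeq])

theorem Gamma1_inv_smul_monicPoly (hr : (hankel (rightSeq b s) N).PosDef)
    (hh : (hankel (hatSeq a b s) N).PosDef) :
    (Gamma1 b s N a)⁻¹ • monicPoly (rightSeq b s) N = unitPoly a (rightSeq b s) N :=
  P1_inv_smul_monicPoly hr (by rwa [leftSeq_rightSeq])

theorem monicPoly_leftSeq_eq_Theta2_smul (hs : (hankel s (N + 1)).PosDef)
    (hl : (hankel (leftSeq a s) N).PosDef) :
    monicPoly (leftSeq a s) N = Theta2 a s N a • -kernelPoly a s (N + 1) := by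
  rw [Theta2_self, neg_smul_neg]
  exact monicPoly_leftSeq_eq_smul_kernelPoly hs hl

theorem isUnit_Theta2 (hs : (hankel s (N + 1)).PosDef) (hl : (hankel (leftSeq a s) N).PosDef) :
    IsUnit (Theta2 a s N a) :=
  isUnit_of_eq_smul (coeff_monicPoly _ N) (monicPoly_leftSeq_eq_Theta2_smul hs hl)

theorem Theta2_inv_smul_monicPoly (hs : (hankel s (N + 1)).PosDef)
    (hl : (hankel (leftSeq a s) N).PosDef) :
    (Theta2 a s N a)⁻¹ • monicPoly (leftSeq a s) N = -kernelPoly a s (N + 1) :=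
  inv_smul_eq_of_eq_smul (coeff_monicPoly _ N) (monicPoly_leftSeq_eq_Theta2_smul hs hl)

theorem monicPoly_hatSeq_eq_Q2_smul (hr : (hankel (rightSeq b s) (N + 1)).PosDef)
    (hh : (hankel (hatSeq a b s) N).PosDef) :
    monicPoly (hatSeq a b s) N = Q2 a b s N a • kernelPoly a (rightSeq b s) (N + 1) := by
  rw [← leftSeq_rightSeq] at hh
  rw [Q2_self, ← leftSeq_rightSeq]
  exact monicPoly_leftSeq_eq_smul_kernelPoly hr hh

theorem isUnit_Q2 (hr : (hankel (rightSeq b s) (N + 1)).PosDef)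
    (hh : (hankel (hatSeq a b s) N).PosDef) : IsUnit (Q2 a b s N a) :=
  isUnit_of_eq_smul (coeff_monicPoly _ N) (monicPoly_hatSeq_eq_Q2_smul hr hh)

theorem Q2_inv_smul_monicPoly (hr : (hankel (rightSeq b s) (N + 1)).PosDef)
    (hh : (hankel (hatSeq a b s) N).PosDef) :
    (Q2 a b s N a)⁻¹ • monicPoly (hatSeq a b s) N = kernelPoly a (rightSeq b s) (N + 1) :=
  inv_smul_eq_of_eq_smul (coeff_monicPoly _ N) (monicPoly_hatSeq_eq_Q2_smul hr hh)

end Normalization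

section ValuesAtEndpoint

variable {a b : ℝ} {s : ℕ → Mat q} {N : ℕ}

theorem P1_inv_mul_Q1 (hs : (hankel s N).PosDef) (hl : (hankel (leftSeq a s) N).PosDef) :
    (P1 s N a)⁻¹ * Q1 s N a = -markovValue a s N := by
  rw [Q1_eq, ← smul_eq_mul, ← map_smul, P1_inv_smul_monicPoly hs hl,
    momentPair_divDiffSeq_unitPoly]

theorem Gamma1_inv_mul_Theta1 (hr : (hankel (rightSeq b s) N).PosDef)
    (hh : (hankel (hatSeq a b s) N).PosDef) :
    (Gamma1 b s N a)⁻¹ * Theta1 b s N a = markovValue a (rightSeq b s) N + s 0 := by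
  have h := momentPair_divDiffSeq_rightSeq b s (a : ℂ) (unitPoly a (rightSeq b s) N)
  rw [momentPair_divDiffSeq_unitPoly, momentPair_powSeq_unitPoly, one_mul] at h
  rw [Theta1_eq, ← smul_eq_mul, ← map_smul, ← map_smul, Gamma1_inv_smul_monicPoly hr hh,
    neg_eq_iff_eq_neg.1 h]
  abel

theorem Theta2_inv_mul_Gamma2 (hs : (hankel s (N + 1)).PosDef)
    (hl : (hankel (leftSeq a s) N).PosDef) :
    (Theta2 a s N a)⁻¹ * Gamma2 a s N a = -kernelValue a s (N + 1) := by
  rw [Gamma2_eq, ← smul_eq_mul, ← map_smul, Theta2_inv_smul_monicPoly hs hl, map_neg, kernelValue]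

theorem Q2_inv_mul_P2 (hr : (hankel (rightSeq b s) (N + 1)).PosDef)
    (hh : (hankel (hatSeq a b s) N).PosDef) :
    (Q2 a b s N a)⁻¹ * P2 a b s N a = kernelValue a (rightSeq b s) (N + 1) := by
  rw [P2_eq, ← smul_eq_mul, ← map_smul, Q2_inv_smul_monicPoly hr hh, kernelValue]

end ValuesAtEndpoint

section Adjoint

variable {a b : ℝ} {s : ℕ → Mat q}

/-- The adjoint at `z̄` of the value at `F` of a family `w` of functionals, given by their
moments. -/
def adjPair (w : ℂ → ℕ → Mat q) (F : MatPoly q) (z : ℂ) : Mat q :=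
  starConj (fun x => momentPair (w x) F) z

theorem adjPair_add (w : ℂ → ℕ → Mat q) (F G : MatPoly q) (z : ℂ) :
    adjPair w (F + G) z = adjPair w F z + adjPair w G z := by
  simp only [adjPair, starConj, map_add, Matrix.conjTranspose_add]

theorem adjPair_neg (w : ℂ → ℕ → Mat q) (F : MatPoly q) (z : ℂ) :
    adjPair w (-F) z = -adjPair w F z := by
  simp only [adjPair, starConj, map_neg, Matrix.conjTranspose_neg]

theorem adjPair_sub (w : ℂ → ℕ → Mat q) (F G : MatPoly q) (z : ℂ) :
    adjPair w (F - G) z = adjPair w F z - adjPair w G z := by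
  simp only [adjPair, starConj, map_sub, Matrix.conjTranspose_sub]

theorem adjPair_smul (w : ℂ → ℕ → Mat q) (A : Mat q) (F : MatPoly q) (z : ℂ) :
    adjPair w (A • F) z = adjPair w F z * Aᴴ := by
  simp only [adjPair, starConj, map_smul, smul_eq_mul, Matrix.conjTranspose_mul]

theorem adjPair_mul_inv_conjTranspose (w : ℂ → ℕ → Mat q) (A : Mat q) (F : MatPoly q) (z : ℂ) :
    adjPair w F z * Aᴴ⁻¹ = adjPair w (A⁻¹ • F) z := by
  rw [adjPair_smul, Matrix.conjTranspose_nonsing_inv]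

theorem adjPair_real_smul (w : ℂ → ℕ → Mat q) (c : ℝ) (F : MatPoly q) (z : ℂ) :
    adjPair w ((c : ℂ) • F) z = (c : ℂ) • adjPair w F z := by
  simp only [adjPair, starConj, LinearMap.map_smul_of_tower, Matrix.conjTranspose_smul,
    Complex.star_def, Complex.conj_ofReal]

theorem adjPair_powSeq_mulSub (c : ℝ) (F : MatPoly q) (z : ℂ) :
    adjPair (powSeq (Mat q)) (mulSub (c : ℂ) F) z = (z - c) • adjPair (powSeq (Mat q)) F z := by
  simp only [adjPair, starConj, momentPair_powSeq_mulSub, Matrix.conjTranspose_smul,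
    Complex.star_def, map_sub, Complex.conj_conj, Complex.conj_ofReal]

theorem adjPair_divDiffSeq_mulSub (t : ℕ → Mat q) (c : ℝ) (F : MatPoly q) (z : ℂ) :
    adjPair (divDiffSeq t) (mulSub (c : ℂ) F) z =
      (z - c) • adjPair (divDiffSeq t) F z + (momentPair t F)ᴴ := by
  simp only [adjPair, starConj, momentPair_divDiffSeq_mulSub, Matrix.conjTranspose_add,
    Matrix.conjTranspose_smul, Complex.star_def, map_sub, Complex.conj_conj, Complex.conj_ofReal]

theorem adjPair_divDiffSeq_rightSeq (hs : (s 0).IsHermitian) (F : MatPoly q) (z : ℂ) :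
    adjPair (divDiffSeq (rightSeq b s)) F z =
      -adjPair (divDiffSeq s) (mulSub (b : ℂ) F) z + s 0 * adjPair (powSeq (Mat q)) F z := by
  simp only [adjPair, starConj, momentPair_divDiffSeq_rightSeq, Matrix.conjTranspose_add,
    Matrix.conjTranspose_neg, Matrix.conjTranspose_mul, hs.eq]

theorem starConj_P1 (s : ℕ → Mat q) (j : ℕ) (z : ℂ) :
    starConj (P1 s j) z = adjPair (powSeq (Mat q)) (monicPoly s j) z := by
  simp only [starConj, P1_eq, adjPair]

theorem starConj_P2 (a b : ℝ) (s : ℕ → Mat q) (j : ℕ) (z : ℂ) :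
    starConj (P2 a b s j) z = adjPair (powSeq (Mat q)) (monicPoly (hatSeq a b s) j) z :=
  starConj_P1 _ j z

theorem starConj_Gamma1 (b : ℝ) (s : ℕ → Mat q) (j : ℕ) (z : ℂ) :
    starConj (Gamma1 b s j) z = adjPair (powSeq (Mat q)) (monicPoly (rightSeq b s) j) z :=
  starConj_P1 _ j z

theorem starConj_Gamma2 (a : ℝ) (s : ℕ → Mat q) (j : ℕ) (z : ℂ) :
    starConj (Gamma2 a s j) z = adjPair (powSeq (Mat q)) (monicPoly (leftSeq a s) j) z :=
  starConj_P1 _ j z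

theorem starConj_Q1 (s : ℕ → Mat q) (j : ℕ) (z : ℂ) :
    starConj (Q1 s j) z = adjPair (divDiffSeq s) (monicPoly s j) z := by
  simp only [starConj, Q1_eq, adjPair]

theorem starConj_Q2 (a b : ℝ) (s : ℕ → Mat q) (j : ℕ) (z : ℂ) :
    starConj (Q2 a b s j) z = -adjPair (divDiffSeq s)
      (mulSub (b : ℂ) (mulSub (a : ℂ) (monicPoly (hatSeq a b s) j))) z := by
  simp only [starConj, Q2_eq, adjPair, Matrix.conjTranspose_neg]

theorem starConj_Theta1 (b : ℝ) (s : ℕ → Mat q) (j : ℕ) (z : ℂ) :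
    starConj (Theta1 b s j) z =
      adjPair (divDiffSeq s) (mulSub (b : ℂ) (monicPoly (rightSeq b s) j)) z := by
  simp only [starConj, Theta1_eq, adjPair]

theorem starConj_Theta2 (a : ℝ) (s : ℕ → Mat q) (j : ℕ) (z : ℂ) :
    starConj (Theta2 a s j) z =
      -adjPair (divDiffSeq s) (mulSub (a : ℂ) (monicPoly (leftSeq a s) j)) z := by
  simp only [starConj, Theta2_eq, adjPair, Matrix.conjTranspose_neg]

end Adjoint

section PairMatrix

variable {a b : ℝ} {s t : ℕ → Mat q} {N n : ℕ}

/-- The `2 × 2` block matrix whose block columns are the adjoints at `z̄` of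
`(1 + (z - a) E F, -(z - a) F)` and `(-E G, G)`, where `E` is the divided difference functional of
the moments `t`. -/
def pairMat (a : ℝ) (t : ℕ → Mat q) (F G : MatPoly q) (z : ℂ) :
    Matrix (Fin q ⊕ Fin q) (Fin q ⊕ Fin q) ℂ :=
  Matrix.fromBlocks
    (1 + (z - a) • adjPair (divDiffSeq t) F z)
    (-adjPair (divDiffSeq t) G z)
    (-((z - a) • adjPair (powSeq (Mat q)) F z))
    (adjPair (powSeq (Mat q)) G z)

theorem pairMat_zero_one (a : ℝ) (t : ℕ → Mat q) (z : ℂ) : pairMat a t 0 1 z = 1 := by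
  simp [pairMat, adjPair, starConj, momentPair_one, divDiffSeq, powSeq]

theorem pairMat_mul_lower (a : ℝ) (t : ℕ → Mat q) (F G : MatPoly q) (z : ℂ) (A : Mat q) :
    pairMat a t F G z * lower (-((z - a) • Aᴴ)) = pairMat a t (F + A • G) G z := by
  simp only [pairMat, lower, Matrix.fromBlocks_multiply, adjPair_add, adjPair_smul, mul_one,
    mul_zero, zero_add, mul_neg, neg_mul, neg_neg, smul_neg, mul_smul_comm, smul_add, neg_add,
    add_assoc]

theorem pairMat_mul_upper (a : ℝ) {F : MatPoly q} (hF : momentPair t F = 1) (G : MatPoly q)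
    (z : ℂ) (A : Mat q) :
    pairMat a t F G z * upper Aᴴ = pairMat a t F (G - A • mulSub (a : ℂ) F) z := by
  simp only [pairMat, upper, Matrix.fromBlocks_multiply, adjPair_sub, adjPair_smul,
    adjPair_divDiffSeq_mulSub, adjPair_powSeq_mulSub, hF, Matrix.conjTranspose_one, mul_one,
    mul_zero, add_zero, add_mul, one_mul, smul_mul_assoc, neg_mul]
  congr 1 <;> abel

theorem upper_mul_pairMat_rightSeq (hs : (s 0).IsHermitian) (F G : MatPoly q) (z : ℂ) :
    upper (s 0) * pairMat a (rightSeq b s) F G z =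
      Matrix.fromBlocks
        (1 - (z - a) • adjPair (divDiffSeq s) (mulSub (b : ℂ) F) z)
        (adjPair (divDiffSeq s) (mulSub (b : ℂ) G) z)
        (-((z - a) • adjPair (powSeq (Mat q)) F z))
        (adjPair (powSeq (Mat q)) G z) := by
  simp only [pairMat, upper, Matrix.fromBlocks_multiply, adjPair_divDiffSeq_rightSeq hs, one_mul,
    zero_mul, zero_add, mul_neg, mul_smul_comm, smul_add, smul_neg]
  congr 1 <;> abel

theorem resolventEven_eq_pairMat (hs : (hankel s (n + 1)).PosDef)
    (hl : (hankel (leftSeq a s) n).PosDef) (hr : (hankel (rightSeq b s) n).PosDef)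
    (hh : (hankel (hatSeq a b s) n).PosDef) (z : ℂ) :
    resolventEven a b s n z = pairMat a s (kernelPoly a s (n + 1))
      (-(((1 / (b - a) : ℝ) : ℂ) • mulSub (b : ℂ) (unitPoly a (rightSeq b s) n))) z := by
  rw [resolventEven, pairMat, starConj_Theta1, starConj_Theta2, starConj_Gamma1, starConj_Gamma2,
    neg_mul, adjPair_mul_inv_conjTranspose, adjPair_mul_inv_conjTranspose,
    adjPair_mul_inv_conjTranspose, adjPair_mul_inv_conjTranspose, ← map_smul, ← map_smul,
    Theta2_inv_smul_monicPoly hs hl, Gamma1_inv_smul_monicPoly hr hh]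
  simp only [map_neg, adjPair_neg, adjPair_real_smul, adjPair_powSeq_mulSub, neg_neg, smul_neg]
  congr 1
  · rw [adjPair_divDiffSeq_mulSub, momentPair_kernelPoly hs.isUnit, Matrix.conjTranspose_one,
      add_comm]
  · push_cast
    rfl
  · push_cast
    module

theorem resolventOdd_eq_pairMat (hs : (hankel s (n + 1)).PosDef)
    (hl : (hankel (leftSeq a s) (n + 1)).PosDef) (hr : (hankel (rightSeq b s) (n + 1)).PosDef)
    (hh : (hankel (hatSeq a b s) n).PosDef) (z : ℂ) :
    resolventOdd a b s n z = pairMat a s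
      (-mulSub (b : ℂ) (kernelPoly a (rightSeq b s) (n + 1))) (unitPoly a s (n + 1)) z := by
  rw [resolventOdd, pairMat, starConj_P1, starConj_P2, starConj_Q1, starConj_Q2,
    neg_mul, adjPair_mul_inv_conjTranspose, adjPair_mul_inv_conjTranspose,
    adjPair_mul_inv_conjTranspose, adjPair_mul_inv_conjTranspose, ← map_smul, ← map_smul,
    Q2_inv_smul_monicPoly hr hh, P1_inv_smul_monicPoly hs hl]
  simp only [adjPair_neg, adjPair_powSeq_mulSub]
  congr 1
  · rw [mulSub_comm, adjPair_divDiffSeq_mulSub, neg_add, ← Matrix.conjTranspose_neg,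
      ← momentPair_rightSeq, momentPair_kernelPoly hr.isUnit, Matrix.conjTranspose_one]
    module
  · module

end PairMatrix

section Parameters

variable {a b : ℝ} {s t : ℕ → Mat q} {N : ℕ}

theorem isHermitian_powSeq (a : ℝ) (k : ℕ) : (powSeq (Mat q) (a : ℂ) k).IsHermitian := by
  rw [powSeq, ← Complex.ofReal_pow]
  exact IsSelfAdjoint.smul (Complex.conj_ofReal _) Matrix.isHermitian_one

theorem isHermitian_kernelValue (ht : (hankel t N).PosDef) : (kernelValue a t N).IsHermitian :=
  isHermitian_momentPair_reprPoly ht.isHermitian fun k _ => isHermitian_powSeq a k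

theorem isHermitian_markovValue (ht : (hankel t N).PosDef)
    (hl : (hankel (leftSeq a t) N).PosDef) : (markovValue a t N).IsHermitian :=
  isHermitian_momentPair_reprPoly hl.isHermitian fun _ _ =>
    isHermitian_of_posDef_hankel_leftSeq ht hl (by omega)

theorem quadAt_colV (a : ℝ) (t : ℕ → Mat q) (j : ℕ) :
    quadAt a j (hankel t (j + 1)) (colV q j) = kernelValue a t (j + 1) := by
  rw [quadAt, ← Matrix.conjTranspose_mul, Matrix.mul_assoc _ (resolvR q j a), resolvR_mul_colV,
    conjTranspose_blockCol fun k _ => isHermitian_powSeq a k, kernelValue, kernelPoly,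
    momentPair_reprPoly]

theorem conjTranspose_neg_blockCol_mul_mul (G : Matrix (Fin N × Fin q) (Fin N × Fin q) ℂ)
    {w : ℕ → Mat q} (hw : ∀ k < N, (w k).IsHermitian) :
    (-blockCol N w)ᴴ * G * -blockCol N w = blockRow N w * G * blockCol N w := by
  rw [Matrix.conjTranspose_neg, Matrix.neg_mul, Matrix.neg_mul, Matrix.mul_neg, neg_neg,
    conjTranspose_blockCol hw]

theorem resolvR_mul_colUt2_self (a : ℝ) (t : ℕ → Mat q) (j : ℕ) :
    resolvR q j a * colUt2 a t j = -blockCol (j + 1) t := by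
  rw [resolvR_mul_colUt2]
  simp only [divDiffSeq, add_sub_cancel_left]
  rfl

theorem quadAt_colUt2 (a : ℝ) {j : ℕ} (ht : ∀ k < j + 1, (t k).IsHermitian) :
    quadAt a j (K2 a t (j + 1)) (colUt2 a t j) = markovValue a t (j + 1) := by
  rw [quadAt, ← Matrix.conjTranspose_mul, Matrix.mul_assoc _ (resolvR q j a),
    resolvR_mul_colUt2_self, conjTranspose_neg_blockCol_mul_mul _ ht, markovValue, markovPoly,
    momentPair_reprPoly, K2]

theorem resolvR_mul_colU2_self (a b : ℝ) (s : ℕ → Mat q) (j : ℕ) :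
    resolvR q j a * (colU2 a b s j + (a : ℂ) • (colV q j * s 0)) =
      -blockCol (j + 1) (rightSeq b s) := by
  rw [resolvR_mul_colU2]
  have hblocks (i : ℕ) :
      (divDiffSeq s (a : ℂ) (i + 1 + 1) - (b : ℂ) • divDiffSeq s (a : ℂ) (i + 1)) -
      (a : ℂ) • (divDiffSeq s (a : ℂ) (i + 1) - (b : ℂ) • divDiffSeq s (a : ℂ) i) =
        -rightSeq b s i := by
    simp only [divDiffSeq, rightSeq]
    module
  simp only [hblocks]
  rfl

theorem lSum_eq (a b : ℝ) {j : ℕ} (hs : ∀ k ≤ j + 1, (s k).IsHermitian) :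
    lSum a b s j = markovValue a (rightSeq b s) (j + 1) := by
  have hadj : (colU2 a b s j)ᴴ + (a : ℂ) • (s 0 * (colV q j)ᴴ) =
      (colU2 a b s j + (a : ℂ) • (colV q j * s 0))ᴴ := by
    rw [Matrix.conjTranspose_add, Matrix.conjTranspose_smul, Matrix.conjTranspose_mul,
      (hs 0 (by omega)).eq, Complex.star_def, Complex.conj_ofReal]
  have hr : ∀ k < j + 1, (rightSeq b s k).IsHermitian := fun k hk =>
    isHermitian_rightSeq (hs k (by omega)) (hs (k + 1) (by omega))
  rw [lSum, hadj, ← Matrix.conjTranspose_mul, Matrix.mul_assoc _ (resolvR q j a),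
    resolvR_mul_colU2_self, conjTranspose_neg_blockCol_mul_mul _ hr, markovValue, markovPoly,
    momentPair_reprPoly, leftSeq_rightSeq, H2]

theorem kernelValue_one (ht : IsUnit (hankel t 1)) : kernelValue a t 1 = (t 0)⁻¹ := by
  obtain ⟨A, hA⟩ : ∃ A, kernelPoly a t 1 = C A :=
    ⟨_, eq_C_of_degree_le_zero
      (Order.lt_succ_iff.1 (mem_degreeLT.1 (kernelPoly_mem_degreeLT a t 1)))⟩
  have hmul := momentPair_kernelPoly (a := a) ht
  rw [zero_add, hA, ← monomial_zero_left, momentPair_monomial] at hmul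
  rw [kernelValue, hA, momentPair_powSeq_C, Matrix.inv_eq_left_inv hmul]

theorem bigMPar_eq (ht : IsUnit (hankel t 1)) (k : ℕ) :
    bigMPar a t k = kernelValue a t (k + 1) - kernelValue a t k := by
  cases k with
  | zero => rw [bigMPar, zero_add, kernelValue_one ht, kernelValue_zero, sub_zero]
  | succ k => rw [bigMPar, H1, H1, quadAt_colV, quadAt_colV]

theorem bigLPar_eq {k : ℕ} (ht : ∀ i ≤ k, (t i).IsHermitian) :
    bigLPar a t k = markovValue a t (k + 1) - markovValue a t k := by
  cases k with
  | zero =>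
    have hcol : colUt2 a t 0 = -blockCol 1 t := by
      ext ⟨i, x⟩ y
      fin_cases i
      rfl
    rw [bigLPar, hcol, conjTranspose_neg_blockCol_mul_mul _ fun i _ => ht i (by omega), zero_add,
      markovValue_zero, sub_zero, markovValue, markovPoly, momentPair_reprPoly, K2]
  | succ k =>
    rw [bigLPar, quadAt_colUt2 a fun i _ => ht i (by omega),
      quadAt_colUt2 a fun i _ => ht i (by omega)]

theorem mPar_eq (a b : ℝ) (s : ℕ → Mat q) (k : ℕ) :
    mPar a b s k = kernelValue a (rightSeq b s) (k + 1) - kernelValue a (rightSeq b s) k := by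
  cases k with
  | zero => rw [mPar, K1, quadAt_colV, kernelValue_zero, sub_zero]
  | succ k => rw [mPar, K1, K1, quadAt_colV, quadAt_colV]

theorem lPar_succ_eq {k : ℕ} (hs : ∀ i ≤ k + 1, (s i).IsHermitian) :
    lPar a b s (k + 1) =
      markovValue a (rightSeq b s) (k + 1) - markovValue a (rightSeq b s) k := by
  cases k with
  | zero => rw [lPar, lSum_eq a b hs, markovValue_zero, sub_zero]
  | succ k =>
    rw [lPar, lSum_eq a b hs, lSum_eq a b fun i _ => hs i (by omega)]

end Parameters

section Products

variable {a b : ℝ} {s t : ℕ → Mat q} {N : ℕ}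

theorem rightProd_zero (A : ℕ → Matrix (Fin q ⊕ Fin q) (Fin q ⊕ Fin q) ℂ) : rightProd 0 A = 1 := by
  rw [rightProd, List.range_zero, List.map_nil, List.prod_nil]

theorem rightProd_succ (N : ℕ) (A : ℕ → Matrix (Fin q ⊕ Fin q) (Fin q ⊕ Fin q) ℂ) :
    rightProd (N + 1) A = rightProd N A * A N := by
  rw [rightProd, List.range_succ, List.map_append, List.prod_append, List.map_singleton,
    List.prod_singleton, rightProd]

theorem rightProd_congr {A B : ℕ → Matrix (Fin q ⊕ Fin q) (Fin q ⊕ Fin q) ℂ}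
    (h : ∀ k < N, A k = B k) : rightProd N A = rightProd N B := by
  rw [rightProd, rightProd, List.map_congr_left fun k hk => h k (List.mem_range.1 hk)]

theorem rightProd_mul_mul (N : ℕ) (A B : ℕ → Matrix (Fin q ⊕ Fin q) (Fin q ⊕ Fin q) ℂ) :
    rightProd N (fun k => A k * B k) * A N = A 0 * rightProd N fun k => B k * A (k + 1) := by
  induction N with
  | zero => rw [rightProd_zero, rightProd_zero, one_mul, mul_one]
  | succ N ih => simp only [rightProd_succ, ← mul_assoc, ih]

theorem pairMat_mul_lower_kernelValue (ht : (hankel t N).PosDef) (ht' : (hankel t (N + 1)).PosDef)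
    (hl : (hankel (leftSeq a t) N).PosDef) (z : ℂ) :
    pairMat a t (kernelPoly a t N) (unitPoly a t N) z *
        lower (-((z - a) • (kernelValue a t (N + 1) - kernelValue a t N))) =
      pairMat a t (kernelPoly a t (N + 1)) (unitPoly a t N) z := by
  have hherm : (kernelValue a t (N + 1) - kernelValue a t N).IsHermitian :=
    (isHermitian_kernelValue ht').sub (isHermitian_kernelValue ht)
  rw [← hherm.eq, pairMat_mul_lower, ← kernelPoly_succ ht.isUnit ht'.isUnit hl.isUnit]

theorem pairMat_mul_upper_markovValue (ht : (hankel t (N + 1)).PosDef)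
    (hl : (hankel (leftSeq a t) N).PosDef) (hl' : (hankel (leftSeq a t) (N + 1)).PosDef) (z : ℂ) :
    pairMat a t (kernelPoly a t (N + 1)) (unitPoly a t N) z *
        upper (markovValue a t (N + 1) - markovValue a t N) =
      pairMat a t (kernelPoly a t (N + 1)) (unitPoly a t (N + 1)) z := by
  have hherm : (markovValue a t (N + 1) - markovValue a t N).IsHermitian :=
    (isHermitian_markovValue ht hl').sub
      (isHermitian_markovValue (posDef_hankel_of_le ht N.le_succ) hl)
  rw [← hherm.eq, pairMat_mul_upper a (momentPair_kernelPoly ht.isUnit),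
    ← unitPoly_succ ht.isUnit hl.isUnit hl'.isUnit]

theorem pairMat_eq_rightProd (ht : (hankel t N).PosDef) (hl : (hankel (leftSeq a t) N).PosDef)
    (z : ℂ) :
    pairMat a t (kernelPoly a t N) (unitPoly a t N) z = rightProd N fun k =>
      lower (-((z - a) • (kernelValue a t (k + 1) - kernelValue a t k))) *
        upper (markovValue a t (k + 1) - markovValue a t k) := by
  induction N with
  | zero => rw [kernelPoly_zero, unitPoly_zero, pairMat_zero_one, rightProd_zero]
  | succ N ih =>
    have ht' := posDef_hankel_of_le ht N.le_succ
    have hl' := posDef_hankel_of_le hl N.le_succ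
    rw [rightProd_succ, ← ih ht' hl', ← mul_assoc, pairMat_mul_lower_kernelValue ht' ht hl',
      pairMat_mul_upper_markovValue ht hl' hl]

theorem pairMat_eq_rightProd_bigMPar_bigLPar (ht : (hankel t N).PosDef)
    (hl : (hankel (leftSeq a t) N).PosDef) (z : ℂ) :
    pairMat a t (kernelPoly a t N) (unitPoly a t N) z = rightProd N fun k =>
      lower (-((z - a) • bigMPar a t k)) * upper (bigLPar a t k) := by
  rw [pairMat_eq_rightProd ht hl]
  refine rightProd_congr fun k hk => ?_
  rw [bigMPar_eq (posDef_hankel_of_le ht (by omega)).isUnit,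
    bigLPar_eq fun i _ => isHermitian_of_posDef_hankel_leftSeq ht hl (by omega)]

theorem pairMat_eq_rightProd_mul_lower_bigMPar (ht : (hankel t (N + 1)).PosDef)
    (hl : (hankel (leftSeq a t) N).PosDef) (z : ℂ) :
    pairMat a t (kernelPoly a t (N + 1)) (unitPoly a t N) z =
      (rightProd N fun k => lower (-((z - a) • bigMPar a t k)) * upper (bigLPar a t k)) *
        lower (-((z - a) • bigMPar a t N)) := by
  have ht' := posDef_hankel_of_le ht N.le_succ
  rw [bigMPar_eq (posDef_hankel_of_le ht N.succ_pos).isUnit,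
    ← pairMat_eq_rightProd_bigMPar_bigLPar ht' hl, pairMat_mul_lower_kernelValue ht' ht hl]

theorem rightProd_lPar_mPar_mul_upper (hs : ∀ i ≤ N, (s i).IsHermitian)
    (hr : (hankel (rightSeq b s) N).PosDef) (hh : (hankel (hatSeq a b s) N).PosDef) (z : ℂ) :
    rightProd N (fun k => upper (lPar a b s k) * lower (-((z - a) • mPar a b s k))) *
        upper (lPar a b s N) =
      upper (s 0) * pairMat a (rightSeq b s) (kernelPoly a (rightSeq b s) N)
        (unitPoly a (rightSeq b s) N) z := by
  rw [rightProd_mul_mul N (fun k => upper (lPar a b s k)), lPar,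
    pairMat_eq_rightProd hr (by rwa [leftSeq_rightSeq])]
  congr 1
  refine rightProd_congr fun k hk => ?_
  rw [mPar_eq, lPar_succ_eq fun i _ => hs i (by omega)]

theorem rightProd_succ_lPar_mPar (hs : ∀ i ≤ N, (s i).IsHermitian)
    (hr : (hankel (rightSeq b s) (N + 1)).PosDef) (hh : (hankel (hatSeq a b s) N).PosDef) (z : ℂ) :
    rightProd (N + 1) (fun k => upper (lPar a b s k) * lower (-((z - a) • mPar a b s k))) =
      upper (s 0) * pairMat a (rightSeq b s) (kernelPoly a (rightSeq b s) (N + 1))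
        (unitPoly a (rightSeq b s) N) z := by
  have hr' := posDef_hankel_of_le hr N.le_succ
  rw [rightProd_succ, ← mul_assoc, rightProd_lPar_mPar_mul_upper hs hr' hh, mPar_eq, mul_assoc,
    pairMat_mul_lower_kernelValue hr' hr (by rwa [leftSeq_rightSeq])]

end Products

section Comparison

variable {a b : ℝ} {s : ℕ → Mat q} {n : ℕ} {F : MatPoly q}

theorem ofReal_one_div_sub_mul (hab : a < b) :
    ((1 / (b - a) : ℝ) : ℂ) * ((b : ℂ) - a) = 1 := by
  rw [← Complex.ofReal_sub, ← Complex.ofReal_mul, one_div_mul_cancel (sub_pos.2 hab).ne',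
    Complex.ofReal_one]

theorem IsOrth.rightSeq_of_succ (hF : IsOrth s (n + 1) F) : IsOrth (rightSeq b s) n F := by
  intro k hk
  have hsucc := momentPair_shift_succ b s k F
  rw [hF k (by omega), hF (k + 1) (by omega), smul_zero, add_zero] at hsucc
  simp only [rightSeq_eq_neg_leftSeq, momentPair_neg_seq, ← hsucc, neg_zero]

theorem momentPair_divDiffSeq_mulSub_unitPoly_rightSeq (a b : ℝ) (s : ℕ → Mat q) (n : ℕ) :
    momentPair (divDiffSeq s (a : ℂ)) (mulSub (b : ℂ) (unitPoly a (rightSeq b s) n)) =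
      markovValue a (rightSeq b s) n + s 0 := by
  have h := momentPair_divDiffSeq_rightSeq b s (a : ℂ) (unitPoly a (rightSeq b s) n)
  rw [momentPair_divDiffSeq_unitPoly, momentPair_powSeq_unitPoly, one_mul,
    neg_eq_iff_eq_neg, neg_add, neg_neg] at h
  rw [h, neg_add_cancel_right]

theorem neg_smul_mulSub_unitPoly_rightSeq (hab : a < b) (hs : IsUnit (hankel s (n + 1)))
    (hl : IsUnit (hankel (leftSeq a s) n)) (hh : IsUnit (hankel (hatSeq a b s) n)) :
    -(((1 / (b - a) : ℝ) : ℂ) • mulSub (b : ℂ) (unitPoly a (rightSeq b s) n)) =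
      unitPoly a s n - (((1 / (b - a) : ℝ) : ℂ) • (markovValue a (rightSeq b s) n + s 0) -
        markovValue a s n) • mulSub (a : ℂ) (kernelPoly a s (n + 1)) := by
  set c : ℂ := ((1 / (b - a) : ℝ) : ℂ)
  set u : MatPoly q := mulSub (b : ℂ) (unitPoly a (rightSeq b s) n)
  have hu : IsOrth s n u :=
    isOrth_rightSeq_iff.1 (isOrth_unitPoly (by rwa [leftSeq_rightSeq]))
  have horth : IsOrth s n (-c • u - unitPoly a s n) := (hu.smul _).sub (isOrth_unitPoly hl)
  have hdeg : -c • u - unitPoly a s n ∈ degreeLT (Mat q) (n + 2) :=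
    sub_mem (Submodule.smul_of_tower_mem _ _ (mulSub_mem_degreeLT _ (unitPoly_mem_degreeLT _ _ _)))
      (degreeLT_mono (Nat.le_succ _) (unitPoly_mem_degreeLT _ _ _))
  have hroot : momentPair (powSeq (Mat q) (a : ℂ)) (-c • u - unitPoly a s n) = 0 := by
    rw [map_sub, LinearMap.map_smul_of_tower, momentPair_powSeq_mulSub,
      momentPair_powSeq_unitPoly, momentPair_powSeq_unitPoly, smul_smul, neg_mul_comm, neg_sub,
      ofReal_one_div_sub_mul hab, one_smul, sub_self]
  have h := horth.eq_smul_mulSub_kernelPoly hs hdeg hroot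
  rw [map_sub, LinearMap.map_smul_of_tower, momentPair_divDiffSeq_mulSub_unitPoly_rightSeq,
    momentPair_divDiffSeq_unitPoly, sub_eq_iff_eq_add'] at h
  rw [← neg_smul, h, sub_eq_add_neg (unitPoly a s n), ← neg_smul (_ - _)]
  congr 3
  rw [neg_smul, neg_sub, sub_neg_eq_add, neg_add_eq_sub]

theorem smul_kernelPoly_eq_kernelPoly_rightSeq_add (hab : a < b) (hs : IsUnit (hankel s (n + 1)))
    (hr : IsUnit (hankel (rightSeq b s) n)) (hh : IsUnit (hankel (hatSeq a b s) n)) :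
    ((1 / (b - a) : ℝ) : ℂ) • kernelPoly a s (n + 1) = kernelPoly a (rightSeq b s) n +
      (((1 / (b - a) : ℝ) : ℂ) • kernelValue a s (n + 1) - kernelValue a (rightSeq b s) n) •
        unitPoly a (rightSeq b s) n := by
  set c : ℂ := ((1 / (b - a) : ℝ) : ℂ)
  have horth : IsOrth (rightSeq b s) n
      (c • kernelPoly a s (n + 1) - kernelPoly a (rightSeq b s) n) := by
    intro k hk
    have hk' : momentPair (fun i => leftSeq b s (i + k)) (kernelPoly a s (n + 1)) =
        -(((b : ℂ) - a) • powSeq (Mat q) (a : ℂ) k) := by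
      have hsucc := momentPair_shift_succ b s k (kernelPoly a s (n + 1))
      rw [momentPair_shift_kernelPoly hs (by omega), momentPair_shift_kernelPoly hs (by omega),
        ← sub_eq_iff_eq_add] at hsucc
      rw [← hsucc, powSeq, powSeq]
      module
    rw [map_sub, LinearMap.map_smul_of_tower, momentPair_shift_kernelPoly hr hk]
    simp only [rightSeq_eq_neg_leftSeq, momentPair_neg_seq, hk', neg_neg, smul_smul,
      ofReal_one_div_sub_mul hab, c, one_smul, sub_self]
  have hdeg : c • kernelPoly a s (n + 1) - kernelPoly a (rightSeq b s) n ∈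
      degreeLT (Mat q) (n + 1) :=
    sub_mem (Submodule.smul_of_tower_mem _ c (kernelPoly_mem_degreeLT _ _ _))
      (degreeLT_mono n.le_succ (kernelPoly_mem_degreeLT _ _ _))
  have h := horth.eq_smul_unitPoly (a := a) (by rwa [leftSeq_rightSeq]) hdeg
  rwa [map_sub, LinearMap.map_smul_of_tower, sub_eq_iff_eq_add'] at h

theorem unitPoly_succ_eq_unitPoly_rightSeq_sub (hr : IsUnit (hankel (rightSeq b s) (n + 1)))
    (hl : IsUnit (hankel (leftSeq a s) (n + 1))) (hh : IsUnit (hankel (hatSeq a b s) n)) :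
    unitPoly a s (n + 1) = unitPoly a (rightSeq b s) n -
      (-(markovValue a (rightSeq b s) n + s 0) + ((b - a : ℝ) : ℂ) • markovValue a s (n + 1)) •
        mulSub (a : ℂ) (kernelPoly a (rightSeq b s) (n + 1)) := by
  have horth : IsOrth (rightSeq b s) n (unitPoly a s (n + 1) - unitPoly a (rightSeq b s) n) :=
    (isOrth_unitPoly hl).rightSeq_of_succ.sub (isOrth_unitPoly (by rwa [leftSeq_rightSeq]))
  have hdeg : unitPoly a s (n + 1) - unitPoly a (rightSeq b s) n ∈ degreeLT (Mat q) (n + 2) :=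
    sub_mem (unitPoly_mem_degreeLT _ _ _)
      (degreeLT_mono (Nat.le_succ _) (unitPoly_mem_degreeLT _ _ _))
  have h := horth.eq_smul_mulSub_kernelPoly hr hdeg (by
    rw [map_sub, momentPair_powSeq_unitPoly, momentPair_powSeq_unitPoly, sub_self])
  rw [map_sub, momentPair_divDiffSeq_unitPoly, momentPair_divDiffSeq_rightSeq,
    momentPair_divDiffSeq_mulSub, momentPair_unitPoly hl, momentPair_divDiffSeq_unitPoly,
    momentPair_powSeq_unitPoly, one_mul, sub_eq_iff_eq_add'] at h
  rw [h, ← sub_neg_eq_add, ← neg_smul]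
  congr 2
  push_cast
  module

theorem neg_mulSub_kernelPoly_rightSeq (hs : IsUnit (hankel s (n + 1)))
    (hr : IsUnit (hankel (rightSeq b s) (n + 1))) (hl : IsUnit (hankel (leftSeq a s) (n + 1))) :
    -mulSub (b : ℂ) (kernelPoly a (rightSeq b s) (n + 1)) = kernelPoly a s (n + 1) +
      (((b - a : ℝ) : ℂ) • kernelValue a (rightSeq b s) (n + 1) - kernelValue a s (n + 1)) •
        unitPoly a s (n + 1) := by
  set k : MatPoly q := kernelPoly a (rightSeq b s) (n + 1)
  have horth : IsOrth s (n + 1) (-mulSub (b : ℂ) k - kernelPoly a s (n + 1)) := by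
    intro j hj
    rw [map_sub, map_neg, ← momentPair_rightSeq_shift, momentPair_shift_kernelPoly hs hj,
      momentPair_shift_kernelPoly hr hj, sub_self]
  have hdeg : -mulSub (b : ℂ) k - kernelPoly a s (n + 1) ∈ degreeLT (Mat q) (n + 2) :=
    sub_mem (neg_mem (mulSub_mem_degreeLT _ (kernelPoly_mem_degreeLT _ _ _)))
      (degreeLT_mono (Nat.le_succ _) (kernelPoly_mem_degreeLT _ _ _))
  have h := horth.eq_smul_unitPoly hl hdeg
  have hvalue : momentPair (powSeq (Mat q) (a : ℂ)) (-mulSub (b : ℂ) k) =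
      ((b - a : ℝ) : ℂ) • kernelValue a (rightSeq b s) (n + 1) := by
    rw [map_neg, momentPair_powSeq_mulSub, ← neg_smul, neg_sub, Complex.ofReal_sub, kernelValue]
  rwa [map_sub, hvalue, sub_eq_iff_eq_add'] at h

end Comparison

section ScalarConjugation

variable {c : ℂ}

theorem scalDiag_mul_scalDiag (c d c' d' : ℂ) :
    scalDiag q c d * scalDiag q c' d' = scalDiag q (c * c') (d * d') := by
  simp [scalDiag, Matrix.fromBlocks_multiply, smul_smul, mul_comm]

/-- Conjugation by `diag(c I, I)`, which multiplies the lower left block by `c` and divides the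
upper right one by `c`. -/
def scalConj (c : ℂ) (A : Matrix (Fin q ⊕ Fin q) (Fin q ⊕ Fin q) ℂ) :
    Matrix (Fin q ⊕ Fin q) (Fin q ⊕ Fin q) ℂ :=
  scalDiag q (1 / c) 1 * A * scalDiag q c 1

theorem scalConj_mul (hc : c ≠ 0) (A B : Matrix (Fin q ⊕ Fin q) (Fin q ⊕ Fin q) ℂ) :
    scalConj c (A * B) = scalConj c A * scalConj c B := by
  have hinv : scalDiag q c 1 * scalDiag q (1 / c) 1 = 1 := by
    rw [scalDiag_mul_scalDiag, mul_one_div_cancel hc, mul_one, scalDiag, one_smul,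
      Matrix.fromBlocks_one]
  calc scalConj c (A * B)
      = scalDiag q (1 / c) 1 * A * 1 * B * scalDiag q c 1 := by
        rw [scalConj, mul_one, mul_assoc _ A]
    _ = scalConj c A * scalConj c B := by
        rw [← hinv]
        simp only [scalConj, mul_assoc]

theorem scalConj_one (hc : c ≠ 0) :
    scalConj c (1 : Matrix (Fin q ⊕ Fin q) (Fin q ⊕ Fin q) ℂ) = 1 := by
  rw [scalConj, mul_one, scalDiag_mul_scalDiag, one_div_mul_cancel hc, mul_one, scalDiag, one_smul,
    Matrix.fromBlocks_one]

theorem scalConj_upper_smul (hc : c ≠ 0) (X : Mat q) : scalConj c (upper (c • X)) = upper X := by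
  simp [scalConj, scalDiag, upper, Matrix.fromBlocks_multiply, smul_smul, hc]

theorem scalConj_lower (hc : c ≠ 0) (X : Mat q) : scalConj c (lower X) = lower (c • X) := by
  simp [scalConj, scalDiag, lower, Matrix.fromBlocks_multiply, smul_smul, hc]

theorem scalConj_rightProd (hc : c ≠ 0) (N : ℕ)
    (A : ℕ → Matrix (Fin q ⊕ Fin q) (Fin q ⊕ Fin q) ℂ) :
    scalConj c (rightProd N A) = rightProd N fun k => scalConj c (A k) := by
  induction N with
  | zero => rw [rightProd_zero, rightProd_zero, scalConj_one hc]
  | succ N ih => rw [rightProd_succ, rightProd_succ, scalConj_mul hc, ih]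

theorem scalDiag_mul_mul_scalDiag (c d e f : ℂ)
    (A : Matrix (Fin q ⊕ Fin q) (Fin q ⊕ Fin q) ℂ) :
    scalDiag q (1 / (d * c)) 1 * A * scalDiag q (e * c) f =
      scalDiag q (1 / d) 1 * scalConj c A * scalDiag q e f := by
  have hleft : scalDiag q (1 / (d * c)) 1 = scalDiag q (1 / d) 1 * scalDiag q (1 / c) 1 := by
    rw [scalDiag_mul_scalDiag, one_div_mul_one_div, one_mul]
  have hright : scalDiag q (e * c) f = scalDiag q c 1 * scalDiag q e f := by
    rw [scalDiag_mul_scalDiag, mul_comm c, one_mul]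
  simp only [hleft, hright, scalConj, mul_assoc]

end ScalarConjugation

section Transfer

variable {a b : ℝ} {s : ℕ → Mat q}

theorem scalDiag_mul_fromBlocks_mul_scalDiag (c c' d d' : ℂ) (A B C D : Mat q) :
    scalDiag q c d * Matrix.fromBlocks A B C D * scalDiag q c' d' =
      Matrix.fromBlocks ((c * c') • A) ((c * d') • B) ((d * c') • C) ((d * d') • D) := by
  simp [scalDiag, Matrix.fromBlocks_multiply, smul_smul, mul_comm]

theorem pairMat_neg_mulSub_eq (hs : (s 0).IsHermitian) (F : MatPoly q) {G : MatPoly q}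
    (hG : momentPair s G = 0) {z : ℂ} (hz : z ≠ b) :
    pairMat a s (-mulSub (b : ℂ) F) G z =
      scalDiag q (1 / (b - z)) 1 * (upper (s 0) * pairMat a (rightSeq b s) F G z) *
        scalDiag q (b - z) 1 := by
  have hbz : (b : ℂ) - z ≠ 0 := sub_ne_zero.2 hz.symm
  rw [upper_mul_pairMat_rightSeq hs, scalDiag_mul_fromBlocks_mul_scalDiag, pairMat]
  simp only [adjPair_neg, adjPair_powSeq_mulSub, adjPair_divDiffSeq_mulSub s b G, hG,
    Matrix.conjTranspose_zero, add_zero]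
  congr 1 <;> match_scalars <;> field_simp <;> ring

theorem pairMat_neg_smul_mulSub_eq (hab : a < b) (hs : (s 0).IsHermitian) {F : MatPoly q}
    (hF : momentPair s F = 1) (G : MatPoly q) {z : ℂ} (hz : z ≠ b) :
    pairMat a s F (-(((1 / (b - a) : ℝ) : ℂ) • mulSub (b : ℂ) G)) z =
      scalDiag q (1 / (b - z)) 1 *
        (upper (s 0) * pairMat a (rightSeq b s) (((1 / (b - a) : ℝ) : ℂ) • F) G z) *
        scalDiag q (b - a) ((b - z) / (b - a)) := by
  have hbz : (b : ℂ) - z ≠ 0 := sub_ne_zero.2 hz.symm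
  have hba : (b : ℂ) - a ≠ 0 := sub_ne_zero.2 (Complex.ofReal_injective.ne hab.ne')
  rw [upper_mul_pairMat_rightSeq hs, scalDiag_mul_fromBlocks_mul_scalDiag, pairMat]
  simp only [LinearMap.map_smul_of_tower, adjPair_neg, adjPair_real_smul, adjPair_powSeq_mulSub,
    adjPair_divDiffSeq_mulSub s b F, hF, Matrix.conjTranspose_one, neg_neg]
  push_cast
  congr 1
  · match_scalars <;> field_simp <;> ring
  · match_scalars; field_simp
  · match_scalars; field_simp
  · match_scalars; field_simp; ring

end Transfer

theorem conjTranspose_mul_inv_conjTranspose (A B : Mat q) : Aᴴ * Bᴴ⁻¹ = (B⁻¹ * A)ᴴ := by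
  rw [Matrix.conjTranspose_mul, Matrix.conjTranspose_nonsing_inv]

namespace HausdorffPosDefEven

variable {a b : ℝ} {s : ℕ → Mat q} {n : ℕ}

theorem posDef_K1 (h : HausdorffPosDefEven a b s n) (hab : a < b) : (K1 b s n).PosDef := by
  refine posDef_hankel_of_smul_eq_add (sub_pos.2 hab) (fun k => ?_) h.2
    (posDef_hankel_leftSeq_leftSeq h.1 b)
  simp only [hatSeq, rightSeq, leftSeq, Complex.ofReal_sub]
  module

theorem posDef_K2 (h : HausdorffPosDefEven a b s n) (hab : a < b) : (K2 a s n).PosDef := by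
  refine posDef_hankel_of_smul_eq_add (sub_pos.2 hab) (fun k => ?_) h.2
    (posDef_hankel_leftSeq_leftSeq h.1 a)
  simp only [hatSeq, leftSeq, Complex.ofReal_sub]
  module

theorem resolventEven_succ_eq_lPar_mPar (h : HausdorffPosDefEven a b s (n + 1)) (hab : a < b)
    {z : ℂ} (hza : z ≠ a) (hzb : z ≠ b) :
    resolventEven a b s (n + 1) z =
      scalDiag q (1 / ((b - z) * (z - a))) 1 *
      rightProd (n + 1) (fun k => upper ((z - a) • lPar a b s k) * lower (-mPar a b s k)) *
      upper ((z - a) • lPar a b s (n + 1)) *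
      lower ((Q2 a b s n a)⁻¹ * P2 a b s n a +
        (1 / (b - a) : ℂ) • ((Theta2 a s (n + 1) a)⁻¹ * Gamma2 a s (n + 1) a)) *
      scalDiag q ((b - a) * (z - a)) ((b - z) / (b - a)) := by
  have hs : (hankel s (n + 2)).PosDef := h.1
  have hl : (hankel (leftSeq a s) (n + 1)).PosDef := h.posDef_K2 hab
  have hr : (hankel (rightSeq b s) (n + 1)).PosDef := h.posDef_K1 hab
  have hherm : ∀ i ≤ n + 1, (s i).IsHermitian := fun i _ =>
    isHermitian_of_posDef_hankel hs (by omega)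
  have hz : z - a ≠ 0 := sub_ne_zero.2 hza
  have hfactor : (Q2 a b s n a)⁻¹ * P2 a b s n a +
      (1 / (b - a) : ℂ) • ((Theta2 a s (n + 1) a)⁻¹ * Gamma2 a s (n + 1) a) =
        -(((1 / (b - a) : ℝ) : ℂ) • kernelValue a s (n + 2) -
          kernelValue a (rightSeq b s) (n + 1))ᴴ := by
    rw [Q2_inv_mul_P2 hr (posDef_hankel_of_le h.2 n.le_succ), Theta2_inv_mul_Gamma2 hs hl,
      Matrix.conjTranspose_sub, Matrix.conjTranspose_smul, (isHermitian_kernelValue hs).eq,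
      (isHermitian_kernelValue hr).eq, Complex.star_def, Complex.conj_ofReal, neg_sub, smul_neg,
      ← sub_eq_add_neg]
    push_cast
    rfl
  rw [hfactor, mul_assoc (scalDiag q _ 1), mul_assoc (scalDiag q _ 1),
    scalDiag_mul_mul_scalDiag, scalConj_mul hz, scalConj_mul hz, scalConj_rightProd hz]
  simp only [scalConj_mul hz, scalConj_lower hz, scalConj_upper_smul hz, smul_neg]
  rw [rightProd_lPar_mPar_mul_upper hherm hr h.2, mul_assoc (upper (s 0)), pairMat_mul_lower,
    ← smul_kernelPoly_eq_kernelPoly_rightSeq_add hab hs.isUnit hr.isUnit h.2.isUnit,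
    ← pairMat_neg_smul_mulSub_eq hab (hherm 0 n.succ.zero_le)
      (momentPair_kernelPoly hs.isUnit) _ hzb, resolventEven_eq_pairMat hs hl hr h.2]

theorem resolventEven_eq_bigMPar_bigLPar (h : HausdorffPosDefEven a b s n) (hab : a < b) (z : ℂ) :
    resolventEven a b s n z =
      rightProd n (fun k => lower (-((z - a) • bigMPar a s k)) * upper (bigLPar a s k)) *
      lower (-((z - a) • bigMPar a s n)) *
      upper ((Q1 s n a)ᴴ * ((P1 s n a)ᴴ)⁻¹ +
        (1 / (b - a) : ℂ) • ((Theta1 b s n a)ᴴ * ((Gamma1 b s n a)ᴴ)⁻¹)) := by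
  have hs : (hankel s (n + 1)).PosDef := h.1
  have hl : (hankel (leftSeq a s) n).PosDef := h.posDef_K2 hab
  have hr : (hankel (rightSeq b s) n).PosDef := h.posDef_K1 hab
  have hfactor : (Q1 s n a)ᴴ * ((P1 s n a)ᴴ)⁻¹ +
        (1 / (b - a) : ℂ) • ((Theta1 b s n a)ᴴ * ((Gamma1 b s n a)ᴴ)⁻¹) =
      (((1 / (b - a) : ℝ) : ℂ) • (markovValue a (rightSeq b s) n + s 0) - markovValue a s n)ᴴ := by
    rw [conjTranspose_mul_inv_conjTranspose, conjTranspose_mul_inv_conjTranspose,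
      P1_inv_mul_Q1 (posDef_hankel_of_le hs n.le_succ) hl, Gamma1_inv_mul_Theta1 hr h.2,
      Matrix.conjTranspose_sub, Matrix.conjTranspose_smul, Matrix.conjTranspose_neg,
      Complex.star_def, Complex.conj_ofReal, neg_add_eq_sub]
    push_cast
    rfl
  rw [hfactor, ← pairMat_eq_rightProd_mul_lower_bigMPar hs hl,
    pairMat_mul_upper a (momentPair_kernelPoly hs.isUnit),
    ← neg_smul_mulSub_unitPoly_rightSeq hab hs.isUnit hl.isUnit h.2.isUnit,
    resolventEven_eq_pairMat hs hl hr h.2]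

end HausdorffPosDefEven

namespace HausdorffPosDefOdd

variable {a b : ℝ} {s : ℕ → Mat q} {n : ℕ}

theorem posDef_H1 (h : HausdorffPosDefOdd a b s n) (hab : a < b) : (H1 s (n + 1)).PosDef := by
  refine posDef_hankel_of_smul_eq_add (sub_pos.2 hab) (fun k => ?_) h.1 h.2
  simp only [rightSeq, leftSeq, Complex.ofReal_sub]
  module

theorem posDef_H2 (h : HausdorffPosDefOdd a b s n) (hab : a < b) : (H2 a b s n).PosDef := by
  refine posDef_hankel_of_smul_eq_add (sub_pos.2 hab) (fun k => ?_)
    (posDef_hankel_leftSeq_leftSeq h.1 a) (posDef_hankel_leftSeq_leftSeq h.2 b)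
  simp only [hatSeq, rightSeq, leftSeq, Complex.ofReal_sub]
  module

theorem resolventOdd_eq_lPar_mPar (h : HausdorffPosDefOdd a b s n) (hab : a < b) {z : ℂ}
    (hz : z ≠ b) :
    resolventOdd a b s n z =
      scalDiag q (1 / (b - z)) 1 *
      rightProd (n + 1) (fun k => upper (lPar a b s k) * lower (-((z - a) • mPar a b s k))) *
      upper (-((Gamma1 b s n a)⁻¹ * Theta1 b s n a) -
        (b - a : ℂ) • ((P1 s (n + 1) a)⁻¹ * Q1 s (n + 1) a)) *
      scalDiag q (b - z) 1 := by
  have hs : (hankel s (n + 1)).PosDef := h.posDef_H1 hab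
  have hh : (hankel (hatSeq a b s) n).PosDef := h.posDef_H2 hab
  have hr : (hankel (rightSeq b s) n).PosDef := posDef_hankel_of_le h.1 n.le_succ
  have hherm : ∀ i ≤ n, (s i).IsHermitian := fun i _ => isHermitian_of_posDef_hankel hs (by omega)
  set A : Mat q := -(markovValue a (rightSeq b s) n + s 0) +
    ((b - a : ℝ) : ℂ) • markovValue a s (n + 1) with hA
  have hA' : A.IsHermitian :=
    ((isHermitian_markovValue hr (by rwa [leftSeq_rightSeq])).add (hherm 0 n.zero_le)).neg.add
      (IsSelfAdjoint.smul (Complex.conj_ofReal _) (isHermitian_markovValue hs h.2))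
  have hfactor : -((Gamma1 b s n a)⁻¹ * Theta1 b s n a) -
      (b - a : ℂ) • ((P1 s (n + 1) a)⁻¹ * Q1 s (n + 1) a) = Aᴴ := by
    rw [hA'.eq, hA, Gamma1_inv_mul_Theta1 hr hh, P1_inv_mul_Q1 hs h.2, smul_neg, sub_neg_eq_add,
      Complex.ofReal_sub]
  rw [hfactor, mul_assoc (scalDiag q (1 / (b - z)) 1), rightProd_succ_lPar_mPar hherm h.1 hh,
    mul_assoc (upper (s 0)), pairMat_mul_upper a (momentPair_kernelPoly h.1.isUnit), hA,
    ← unitPoly_succ_eq_unitPoly_rightSeq_sub h.1.isUnit h.2.isUnit hh.isUnit,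
    ← pairMat_neg_mulSub_eq (hherm 0 n.zero_le) _ (momentPair_unitPoly h.2.isUnit) hz,
    resolventOdd_eq_pairMat hs h.2 h.1 hh]

theorem resolventOdd_eq_bigMPar_bigLPar (h : HausdorffPosDefOdd a b s n) (hab : a < b) {z : ℂ}
    (hz : z ≠ a) :
    resolventOdd a b s n z =
      scalDiag q (1 / (z - a)) 1 *
      rightProd (n + 1) (fun k => lower (-bigMPar a s k) * upper ((z - a) • bigLPar a s k)) *
      lower (-((Gamma2 a s n a)ᴴ * ((Theta2 a s n a)ᴴ)⁻¹) -
        (b - a : ℂ) • ((P2 a b s n a)ᴴ * ((Q2 a b s n a)ᴴ)⁻¹)) *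
      scalDiag q (z - a) 1 := by
  have hs : (hankel s (n + 1)).PosDef := h.posDef_H1 hab
  have hh : (hankel (hatSeq a b s) n).PosDef := h.posDef_H2 hab
  have hza : z - a ≠ 0 := sub_ne_zero.2 hz
  have hfactor : -((Gamma2 a s n a)ᴴ * ((Theta2 a s n a)ᴴ)⁻¹) -
      (b - a : ℂ) • ((P2 a b s n a)ᴴ * ((Q2 a b s n a)ᴴ)⁻¹) =
        -(((b - a : ℝ) : ℂ) • kernelValue a (rightSeq b s) (n + 1) -
          kernelValue a s (n + 1))ᴴ := by
    rw [conjTranspose_mul_inv_conjTranspose, conjTranspose_mul_inv_conjTranspose,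
      Theta2_inv_mul_Gamma2 hs (posDef_hankel_of_le h.2 n.le_succ), Q2_inv_mul_P2 h.1 hh,
      Matrix.conjTranspose_sub, Matrix.conjTranspose_smul, Matrix.conjTranspose_neg,
      Complex.star_def, Complex.conj_ofReal, neg_neg, neg_sub, Complex.ofReal_sub]
  rw [hfactor, mul_assoc (scalDiag q (1 / (z - a)) 1), ← scalConj, scalConj_mul hza,
    scalConj_rightProd hza]
  simp only [scalConj_mul hza, scalConj_lower hza, scalConj_upper_smul hza, smul_neg]
  rw [← pairMat_eq_rightProd_bigMPar_bigLPar hs h.2, pairMat_mul_lower,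
    ← neg_mulSub_kernelPoly_rightSeq hs.isUnit h.1.isUnit h.2.isUnit,
    resolventOdd_eq_pairMat hs h.2 h.1 hh]

end HausdorffPosDefOdd

end THMM

end

theorem theorem5p3 {q : ℕ} (a b : ℝ) (hab : a < b) (s : ℕ → Matrix (Fin q) (Fin q) ℂ) (n : ℕ) :
    -- the case of the moments `s_0, …, s_{2n}`
    (HausdorffPosDefEven a b s n →
      -- the matrices inverted in the definitions and in the formulas are invertible
      ((∀ j ≤ n, (H1 s (j + 1)).PosDef ∧ (H2 a b s j).PosDef ∧ (K1 b s j).PosDef ∧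
          (K2 a s j).PosDef) ∧
        IsUnit (Theta2 a s n a) ∧ IsUnit (Gamma1 b s n a) ∧ IsUnit (P1 s n a) ∧
        (1 ≤ n → IsUnit (Q2 a b s (n - 1) a))) ∧
      -- part a)
      (1 ≤ n → ∀ z : ℂ, z ≠ a → z ≠ b →
        resolventEven a b s n z =
          scalDiag q (1 / ((b - z) * (z - a))) 1 *
          rightProd n (fun k => upper ((z - a) • lPar a b s k) * lower (-mPar a b s k)) *
          upper ((z - a) • lPar a b s n) *
          lower ((Q2 a b s (n - 1) a)⁻¹ * P2 a b s (n - 1) a +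
            (1 / (b - a) : ℂ) • ((Theta2 a s n a)⁻¹ * Gamma2 a s n a)) *
          scalDiag q ((b - a) * (z - a)) ((b - z) / (b - a))) ∧
      -- part b)
      (∀ z : ℂ,
        resolventEven a b s n z =
          rightProd n (fun k => lower (-((z - a) • bigMPar a s k)) * upper (bigLPar a s k)) *
          lower (-((z - a) • bigMPar a s n)) *
          upper ((Q1 s n a)ᴴ * ((P1 s n a)ᴴ)⁻¹ +
            (1 / (b - a) : ℂ) • ((Theta1 b s n a)ᴴ * ((Gamma1 b s n a)ᴴ)⁻¹)))) ∧
    -- the case of the moments `s_0, …, s_{2n+1}`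
    (HausdorffPosDefOdd a b s n →
      -- the matrices inverted in the definitions and in the formulas are invertible
      ((∀ j ≤ n, (H1 s (j + 1)).PosDef ∧ (H2 a b s j).PosDef ∧ (K1 b s (j + 1)).PosDef ∧
          (K2 a s (j + 1)).PosDef) ∧
        IsUnit (Q2 a b s n a) ∧ IsUnit (P1 s (n + 1) a) ∧ IsUnit (Gamma1 b s n a) ∧
        IsUnit (Theta2 a s n a)) ∧
      -- part a)
      (∀ z : ℂ, z ≠ b →
        resolventOdd a b s n z =
          scalDiag q (1 / (b - z)) 1 *
          rightProd (n + 1) (fun k => upper (lPar a b s k) * lower (-((z - a) • mPar a b s k))) *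
          upper (-((Gamma1 b s n a)⁻¹ * Theta1 b s n a) -
            (b - a : ℂ) • ((P1 s (n + 1) a)⁻¹ * Q1 s (n + 1) a)) *
          scalDiag q (b - z) 1) ∧
      -- part b)
      (∀ z : ℂ, z ≠ a →
        resolventOdd a b s n z =
          scalDiag q (1 / (z - a)) 1 *
          rightProd (n + 1)
            (fun k => lower (-bigMPar a s k) * upper ((z - a) • bigLPar a s k)) *
          lower (-((Gamma2 a s n a)ᴴ * ((Theta2 a s n a)ᴴ)⁻¹) -
            (b - a : ℂ) • ((P2 a b s n a)ᴴ * ((Q2 a b s n a)ᴴ)⁻¹)) *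
          scalDiag q (z - a) 1)) := by
  constructor
  · intro h
    have hK1 := h.posDef_K1 hab
    have hK2 := h.posDef_K2 hab
    refine ⟨⟨fun j hj => ⟨posDef_hankel_of_le h.1 (by omega), posDef_hankel_of_le h.2 hj,
      posDef_hankel_of_le hK1 hj, posDef_hankel_of_le hK2 hj⟩, isUnit_Theta2 h.1 hK2,
      isUnit_Gamma1 hK1 h.2, isUnit_P1 (posDef_hankel_of_le h.1 n.le_succ) hK2, fun hn => ?_⟩,
      fun hn z hza hzb => ?_, h.resolventEven_eq_bigMPar_bigLPar hab⟩
    all_goals obtain ⟨m, rfl⟩ := Nat.exists_eq_add_of_le' hn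
    · exact isUnit_Q2 hK1 (posDef_hankel_of_le h.2 m.le_succ)
    · exact h.resolventEven_succ_eq_lPar_mPar hab hza hzb
  · intro h
    have hH1 := h.posDef_H1 hab
    have hH2 := h.posDef_H2 hab
    exact ⟨⟨fun j hj => ⟨posDef_hankel_of_le hH1 (by omega), posDef_hankel_of_le hH2 hj,
      posDef_hankel_of_le h.1 (by omega), posDef_hankel_of_le h.2 (by omega)⟩,
      isUnit_Q2 h.1 hH2, isUnit_P1 hH1 h.2,
      isUnit_Gamma1 (posDef_hankel_of_le h.1 n.le_succ) hH2,
      isUnit_Theta2 hH1 (posDef_hankel_of_le h.2 n.le_succ)⟩,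
      fun _ hz => h.resolventOdd_eq_lPar_mPar hab hz,
      fun _ hz => h.resolventOdd_eq_bigMPar_bigLPar hab hz⟩
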